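/- Let $\Bbbk$ be a field and let $C$ be a coalgebra over $\Bbbk$, with comultiplication $\Delta(c)=\sum c_1\otimes c_2$ and dual convolution algebra $C^*$, $(f*g)(c)=\sum f(c_1)g(c_2)$. Regard $C$ as a right $C^*$-module through $c\leftharpoonup f=\sum f(c_1)c_2$. Call $C$ *right quasi-co-Frobenius* (right QcF) if, as a right $C^*$-module, $C$ embeds in a product $(C^*)^I$ of copies of the right regular module $C^*$. Call $C$ *right semiperfect* if the injective envelope of every simple left $C$-comodule is finite dimensional. Call a category a *QF-category* if it is abelian, has enough projectives, and all of its projective objects are injective. Let $\mathcal M^C$ be the category of right $C$-comodules. Then $C$ is right QcF if and only if $C$ is right semiperfect and $\mathcal M^C$ is a QF-category. -/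

import Mathlib

open CategoryTheory TensorProduct Coalgebra

universe u v

/-- A right comodule over the `k`-coalgebra `C`: a `k`-module `M` with a coassociative and
counital coaction `M → M ⊗ C`. -/
structure RightComodule (k : Type u) (C : Type v) [Field k] [AddCommGroup C] [Module k C]
    [Coalgebra k C] where
  carrier : Type v
  [addCommGroup : AddCommGroup carrier]
  [module : Module k carrier]
  coact : carrier →ₗ[k] carrier ⊗[k] C
  coassoc : TensorProduct.assoc k carrier C C ∘ₗ coact.rTensor C ∘ₗ coact =
    (comul (R := k) (A := C)).lTensor carrier ∘ₗ coact
  counit_coact : (counit (R := k) (A := C)).lTensor carrier ∘ₗ coact =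
    (TensorProduct.mk k carrier k).flip 1

/-- A left comodule over the `k`-coalgebra `C`: a `k`-module `M` with a coassociative and
counital coaction `M → C ⊗ M`. -/
structure LeftComodule (k : Type u) (C : Type v) [Field k] [AddCommGroup C] [Module k C]
    [Coalgebra k C] where
  carrier : Type v
  [addCommGroup : AddCommGroup carrier]
  [module : Module k carrier]
  coact : carrier →ₗ[k] C ⊗[k] carrier
  coassoc : TensorProduct.assoc k C C carrier ∘ₗ
    (comul (R := k) (A := C)).rTensor carrier ∘ₗ coact = coact.lTensor C ∘ₗ coact
  counit_coact : (counit (R := k) (A := C)).rTensor carrier ∘ₗ coact =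
    TensorProduct.mk k k carrier 1

attribute [instance] RightComodule.addCommGroup RightComodule.module
attribute [instance] LeftComodule.addCommGroup LeftComodule.module

namespace RightComodule

variable {k : Type u} {C : Type v} [Field k] [AddCommGroup C] [Module k C] [Coalgebra k C]

/-- Morphisms of right comodules: the linear maps commuting with the coactions. -/
@[ext]
structure Hom (M N : RightComodule k C) where
  toLinearMap : M.carrier →ₗ[k] N.carrier
  comm : N.coact ∘ₗ toLinearMap = toLinearMap.rTensor C ∘ₗ M.coact

/-- The category of right comodules over `C`. -/
instance category : Category (RightComodule k C) where
  Hom M N := Hom M N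
  id M := ⟨LinearMap.id, by rw [LinearMap.rTensor_id]; rfl⟩
  comp f g := ⟨g.toLinearMap ∘ₗ f.toLinearMap, by
    rw [← LinearMap.comp_assoc, g.comm, LinearMap.comp_assoc, f.comm, LinearMap.rTensor_comp,
      LinearMap.comp_assoc]⟩

end RightComodule

namespace LeftComodule

variable {k : Type u} {C : Type v} [Field k] [AddCommGroup C] [Module k C] [Coalgebra k C]

/-- Morphisms of left comodules: the linear maps commuting with the coactions. -/
@[ext]
structure Hom (M N : LeftComodule k C) where
  toLinearMap : M.carrier →ₗ[k] N.carrier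
  comm : N.coact ∘ₗ toLinearMap = toLinearMap.lTensor C ∘ₗ M.coact

/-- The category of left comodules over `C`. -/
instance category : Category (LeftComodule k C) where
  Hom M N := Hom M N
  id M := ⟨LinearMap.id, by rw [LinearMap.lTensor_id]; rfl⟩
  comp f g := ⟨g.toLinearMap ∘ₗ f.toLinearMap, by
    rw [← LinearMap.comp_assoc, g.comm, LinearMap.comp_assoc, f.comm, LinearMap.lTensor_comp,
      LinearMap.comp_assoc]⟩

/-- A subspace `N` of a left comodule is a subcomodule if the coaction maps `N` into the image of
`C ⊗ N`. -/
def IsSubcomodule (M : LeftComodule k C) (N : Submodule k M.carrier) : Prop :=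
  ∀ x ∈ N, M.coact x ∈ LinearMap.range (N.subtype.lTensor C)

/-- Simple left comodules: nonzero, with no subcomodules but zero and the whole. -/
def IsSimple (S : LeftComodule k C) : Prop :=
  Nontrivial S.carrier ∧ ∀ N : Submodule k S.carrier, S.IsSubcomodule N → N = ⊥ ∨ N = ⊤

/-- `i : S ⟶ E` is an injective envelope: `E` is an injective object of the category of left
comodules, `i` is injective, and every nonzero subcomodule of `E` meets the image of `i`. -/
def IsInjectiveEnvelope {S E : LeftComodule k C} (i : S ⟶ E) : Prop :=
  Injective E ∧ Function.Injective i.toLinearMap ∧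
    ∀ N : Submodule k E.carrier, E.IsSubcomodule N → N ≠ ⊥ →
      N ⊓ LinearMap.range i.toLinearMap ≠ ⊥

end LeftComodule

/-- A quasi-Frobenius category: an abelian category with enough projectives all of whose projective
objects are injective. -/
def IsQFCategory (A : Type*) [Category A] : Prop :=
  Nonempty (Abelian A) ∧ EnoughProjectives A ∧ ∀ P : A, Projective P → Injective P

section

variable (k : Type u) (C : Type v) [Field k] [AddCommGroup C] [Module k C] [Coalgebra k C]

/-- Right semiperfect coalgebras: the injective envelope of every simple left comodule is finite
dimensional. -/
def IsRightSemiperfect : Prop :=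
  ∀ S : LeftComodule k C, S.IsSimple →
    ∃ (E : LeftComodule k C) (i : S ⟶ E),
      LeftComodule.IsInjectiveEnvelope i ∧ FiniteDimensional k E.carrier

variable {k C} in
/-- The right action `c ↼ f = ∑ f(c₁) c₂` of the dual `C*` on `C`. -/
noncomputable def rightHit (c : C) (f : WithConv (C →ₗ[k] k)) : C :=
  TensorProduct.lid k C (f.ofConv.rTensor C (comul c))

/-- Right quasi-co-Frobenius coalgebras: `C` embeds, as a right module over the convolution algebra
`C* = WithConv (C →ₗ[k] k)`, in a product of copies of the right regular module `C*`. -/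
def IsRightQcF : Prop :=
  ∃ (I : Type v) (φ : C →ₗ[k] (I → WithConv (C →ₗ[k] k))),
    Function.Injective φ ∧
      ∀ (c : C) (f : WithConv (C →ₗ[k] k)) (i : I), φ (rightHit c f) i = φ c i * f

end

/-!
A right comodule `M` is a left module over the convolution algebra `C*` by `f · m = ∑ m₀ f(m₁)`,
and dually for left comodules. As functionals separate the points of tensor products over a field,
the comodule axioms, morphisms and subcomodules can be read off from these actions, and subspaces,
quotients and direct sums that are stable under the action carry coactions. This shows that right
comodules form an abelian category, whatever `C` is.

The forward direction rests on two consequences of an embedding of `C` in a power of `C*`.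
A right linear `θ : C → C*` with `θ(x)(c) ≠ 0` gives the endomorphism `y ↦ c ↼ θ(y)` of the left
comodule `C`, of finite rank and nonzero at `x`. For a simple `S ⊆ C` take such an endomorphism that
is injective on `S`; as `C` is injective, one of minimal rank can be made the identity on `S`, and
its image is then a retract of `C` and an essential extension of `S`
(`LeftComodule.exists_isInjectiveEnvelope`). So `C` is right semiperfect. On the other hand the
same `θ` make the right comodule `C` a generator (`RightComodule.exists_epi_of_pairing`). A
projective right comodule is therefore a retract of a direct sum of copies of `C`, and such sums are
cofree, hence injective (`RightComodule.injective_sigma_regular`).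

If `C` is right semiperfect, every nonzero `c ∈ C` is detected by a morphism `g : C → E` to a
finite-dimensional injective left comodule: extend to `C` the embedding of a simple subcomodule of
`c ↼ C*` in its envelope. The dual of `E` is a projective right comodule
(`LeftComodule.projective_dual`): a linear lift is averaged with a retraction `C ⊗ E → E` of the
coaction. These duals generate the category by the same criterion as above, so there are enough
projectives. If projectives are injective, then the dual of `E` is a retract of a direct sum of
copies of `C`, so that `E` embeds in a power of `C*`, and composing with the morphisms `g` embeds
`C` in a product of copies of `C*`.
-/

section

/-! ### Coefficients of tensors and rational actions -/

section Coefficients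

variable {k : Type*} [Field k] {M C D : Type*} [AddCommGroup M] [Module k M]
  [AddCommGroup C] [Module k C] [AddCommGroup D] [Module k D]

/-- An element of `M ⊗ C` is determined by its contractions with the functionals on `C`. -/
theorem TensorProduct.eq_of_forall_rid_lTensor {z w : M ⊗[k] C}
    (h : ∀ f : C →ₗ[k] k, TensorProduct.rid k M (f.lTensor M z) =
      TensorProduct.rid k M (f.lTensor M w)) : z = w := by
  classical
  let b := Module.Basis.ofVectorSpace k C
  refine (TensorProduct.equivFinsuppOfBasisRight b).injective (Finsupp.ext fun i ↦ ?_)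
  rw [TensorProduct.equivFinsuppOfBasisRight_apply, TensorProduct.equivFinsuppOfBasisRight_apply,
    h]

theorem TensorProduct.eq_of_forall_lid_rTensor {z w : C ⊗[k] M}
    (h : ∀ f : C →ₗ[k] k, TensorProduct.lid k M (f.rTensor M z) =
      TensorProduct.lid k M (f.rTensor M w)) : z = w := by
  classical
  let b := Module.Basis.ofVectorSpace k C
  refine (TensorProduct.equivFinsuppOfBasisLeft b).injective (Finsupp.ext fun i ↦ ?_)
  rw [TensorProduct.equivFinsuppOfBasisLeft_apply, TensorProduct.equivFinsuppOfBasisLeft_apply,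
    h]

/-- Functionals separate the points of a vector space. -/
theorem Module.eq_of_forall_dual {V : Type*} [AddCommGroup V] [Module k V] {x y : V}
    (h : ∀ f : V →ₗ[k] k, f x = f y) : x = y :=
  sub_eq_zero.1 ((Module.forall_dual_apply_eq_zero_iff k (x - y)).1 fun f ↦ by
    rw [map_sub, h, sub_self])

theorem TensorProduct.rid_lTensor_lid_map_assoc (f : C →ₗ[k] k) (g : D →ₗ[k] k)
    (z : (M ⊗[k] C) ⊗[k] D) :
    TensorProduct.rid k M ((LinearMap.mul' k k ∘ₗ TensorProduct.map f g).lTensor M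
      (TensorProduct.assoc k M C D z)) =
    TensorProduct.rid k M (f.lTensor M (TensorProduct.rid k (M ⊗[k] C) (g.lTensor _ z))) := by
  induction z with
  | zero => simp
  | add x y hx hy => simp only [map_add, hx, hy]
  | tmul x d =>
    induction x with
    | zero => simp
    | add x y hx hy => simp only [add_tmul, map_add, hx, hy]
    | tmul m c => simp [mul_smul, smul_comm (f c)]

theorem TensorProduct.lid_rTensor_lid_map_assoc (f : C →ₗ[k] k) (g : D →ₗ[k] k)
    (z : C ⊗[k] (D ⊗[k] M)) :
    TensorProduct.lid k M ((LinearMap.mul' k k ∘ₗ TensorProduct.map f g).rTensor M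
      ((TensorProduct.assoc k C D M).symm z)) =
    TensorProduct.lid k M (g.rTensor M (TensorProduct.lid k (D ⊗[k] M) (f.rTensor _ z))) := by
  induction z with
  | zero => simp
  | add x y hx hy => simp only [map_add, hx, hy]
  | tmul c x =>
    induction x with
    | zero => simp
    | add x y hx hy => simp only [tmul_add, map_add, hx, hy]
    | tmul d m => simp [mul_smul]

theorem TensorProduct.eq_of_forall_rid_lTensor_map {z w : M ⊗[k] (C ⊗[k] D)}
    (h : ∀ (f : C →ₗ[k] k) (g : D →ₗ[k] k),
      TensorProduct.rid k M ((LinearMap.mul' k k ∘ₗ TensorProduct.map f g).lTensor M z) =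
      TensorProduct.rid k M ((LinearMap.mul' k k ∘ₗ TensorProduct.map f g).lTensor M w)) :
    z = w := by
  obtain ⟨z, rfl⟩ := (TensorProduct.assoc k M C D).surjective z
  obtain ⟨w, rfl⟩ := (TensorProduct.assoc k M C D).surjective w
  refine congrArg _ (eq_of_forall_rid_lTensor fun g ↦ eq_of_forall_rid_lTensor fun f ↦ ?_)
  simpa only [rid_lTensor_lid_map_assoc] using h f g

theorem TensorProduct.eq_of_forall_lid_rTensor_map {z w : (C ⊗[k] D) ⊗[k] M}
    (h : ∀ (f : C →ₗ[k] k) (g : D →ₗ[k] k),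
      TensorProduct.lid k M ((LinearMap.mul' k k ∘ₗ TensorProduct.map f g).rTensor M z) =
      TensorProduct.lid k M ((LinearMap.mul' k k ∘ₗ TensorProduct.map f g).rTensor M w)) :
    z = w := by
  obtain ⟨z, rfl⟩ := (TensorProduct.assoc k C D M).symm.surjective z
  obtain ⟨w, rfl⟩ := (TensorProduct.assoc k C D M).symm.surjective w
  refine congrArg _ (eq_of_forall_lid_rTensor fun f ↦ eq_of_forall_lid_rTensor fun g ↦ ?_)
  simpa only [lid_rTensor_lid_map_assoc] using h f g

/-- The contractions of a tensor span a finite-dimensional space. -/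
theorem TensorProduct.finiteDimensional_range_of_lid_rTensor (z : C ⊗[k] M) :
    FiniteDimensional k (LinearMap.range ((TensorProduct.lid k M).toLinearMap ∘ₗ
      LinearMap.applyₗ z ∘ₗ LinearMap.rTensorHom (R := k) (M := M) (N := C) (P := k))) := by
  classical
  obtain ⟨s, rfl⟩ := TensorProduct.exists_finset z
  have : FiniteDimensional k (Submodule.span k ((s.image Prod.snd : Finset M) : Set M)) :=
    FiniteDimensional.span_finset k _
  refine Submodule.finiteDimensional_of_le
    (S₂ := Submodule.span k ((s.image Prod.snd : Finset M) : Set M)) ?_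
  rintro _ ⟨f, rfl⟩
  change TensorProduct.lid k M (f.rTensor M _) ∈ _
  rw [map_sum, map_sum]
  refine sum_mem fun i hi ↦ ?_
  have hm : i.2 ∈ Submodule.span k ((s.image Prod.snd : Finset M) : Set M) :=
    Submodule.subset_span (Finset.mem_coe.2 (Finset.mem_image_of_mem _ hi))
  simpa using Submodule.smul_mem _ (f i.1) hm

theorem TensorProduct.rid_lTensor_rTensor {A B : Type*} [AddCommGroup A] [Module k A]
    [AddCommGroup B] [Module k B] (φ : A →ₗ[k] B)
    (f : C →ₗ[k] k) (z : A ⊗[k] C) :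
    TensorProduct.rid k B (f.lTensor B (φ.rTensor C z)) =
      φ (TensorProduct.rid k A (f.lTensor A z)) := by
  induction z with
  | zero => simp
  | add x y hx hy => simp only [map_add, hx, hy]
  | tmul a c => simp

theorem TensorProduct.lid_rTensor_lTensor {A B : Type*} [AddCommGroup A] [Module k A]
    [AddCommGroup B] [Module k B] (φ : A →ₗ[k] B)
    (f : C →ₗ[k] k) (z : C ⊗[k] A) :
    TensorProduct.lid k B (f.rTensor B (φ.lTensor C z)) =
      φ (TensorProduct.lid k A (f.rTensor A z)) := by
  induction z with
  | zero => simp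
  | add x y hx hy => simp only [map_add, hx, hy]
  | tmul a c => simp

end Coefficients

variable {k : Type u} {C : Type v} [Field k] [AddCommGroup C] [Module k C] [Coalgebra k C]

/-- The convolution product `(f * g)(c) = ∑ f(c₁) g(c₂)` of two functionals on a coalgebra. -/
noncomputable def conv (f g : C →ₗ[k] k) : C →ₗ[k] k :=
  (LinearMap.mul' k k ∘ₗ TensorProduct.map f g) ∘ₗ comul

namespace RightComodule

/-- The left action `f · m = ∑ m₀ f(m₁)` of functionals on a right comodule. -/
noncomputable def act (M : RightComodule k C) (f : C →ₗ[k] k) : M.carrier →ₗ[k] M.carrier :=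
  (TensorProduct.rid k M.carrier).toLinearMap ∘ₗ f.lTensor M.carrier ∘ₗ M.coact

theorem act_apply (M : RightComodule k C) (f : C →ₗ[k] k) (m : M.carrier) :
    M.act f m = TensorProduct.rid k M.carrier (f.lTensor M.carrier (M.coact m)) := rfl

@[simp]
theorem act_counit (M : RightComodule k C) (m : M.carrier) : M.act counit m = m := by
  have := LinearMap.congr_fun M.counit_coact m
  simp only [LinearMap.comp_apply] at this
  rw [act_apply, this]
  simp

theorem act_act (M : RightComodule k C) (f g : C →ₗ[k] k) (m : M.carrier) :
    M.act f (M.act g m) = M.act (conv f g) m := by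
  have := LinearMap.congr_fun M.coassoc m
  simp only [LinearMap.comp_apply, LinearEquiv.coe_coe] at this
  rw [act_apply M f, act_apply M g, ← TensorProduct.rid_lTensor_rTensor,
    ← TensorProduct.rid_lTensor_lid_map_assoc,
    this, act_apply, conv, ← LinearMap.lTensor_comp_apply]

@[simp]
theorem act_add (M : RightComodule k C) (f g : C →ₗ[k] k) (m : M.carrier) :
    M.act (f + g) m = M.act f m + M.act g m := by
  simp [act_apply, LinearMap.lTensor_add]

@[simp]
theorem act_smul (M : RightComodule k C) (a : k) (f : C →ₗ[k] k) (m : M.carrier) :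
    M.act (a • f) m = a • M.act f m := by
  simp [act_apply, LinearMap.lTensor_smul]

/-- A linear map that commutes with the actions of all functionals is a comodule morphism. -/
def homOfAct {M N : RightComodule k C} (φ : M.carrier →ₗ[k] N.carrier)
    (h : ∀ f m, φ (M.act f m) = N.act f (φ m)) : M ⟶ N where
  toLinearMap := φ
  comm := by
    ext m
    refine TensorProduct.eq_of_forall_rid_lTensor fun f ↦ ?_
    rw [LinearMap.comp_apply, LinearMap.comp_apply, TensorProduct.rid_lTensor_rTensor]
    exact (h f m).symm

@[simp]
theorem homOfAct_toLinearMap {M N : RightComodule k C} (φ : M.carrier →ₗ[k] N.carrier)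
    (h : ∀ f m, φ (M.act f m) = N.act f (φ m)) : (homOfAct φ h).toLinearMap = φ := rfl

theorem map_act {M N : RightComodule k C} (φ : M ⟶ N) (f : C →ₗ[k] k) (m : M.carrier) :
    φ.toLinearMap (M.act f m) = N.act f (φ.toLinearMap m) := by
  rw [act_apply, act_apply, ← TensorProduct.rid_lTensor_rTensor]
  exact congrArg (fun z ↦ TensorProduct.rid k _ (f.lTensor _ z))
    (LinearMap.congr_fun φ.comm m).symm

@[simp]
theorem comp_toLinearMap_apply {M N P : RightComodule k C} (φ : M ⟶ N) (ψ : N ⟶ P)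
    (m : M.carrier) : (φ ≫ ψ).toLinearMap m = ψ.toLinearMap (φ.toLinearMap m) := rfl

@[simp]
theorem id_toLinearMap_apply {M : RightComodule k C} (m : M.carrier) :
    Hom.toLinearMap (𝟙 M) m = m := rfl

theorem hom_ext {M N : RightComodule k C} {φ ψ : M ⟶ N}
    (h : ∀ m, φ.toLinearMap m = ψ.toLinearMap m) : φ = ψ :=
  Hom.ext (LinearMap.ext h)

/-- Since functionals separate the points of `A ⊗ C` and `A ⊗ (C ⊗ C)`, a linear map `A → A ⊗ C`
is a coaction as soon as it induces an action of the convolution algebra. -/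
theorem exists_of_act {A : Type v} [AddCommGroup A] [Module k A] (ρ : A →ₗ[k] A ⊗[k] C)
    (α : (C →ₗ[k] k) → A → A)
    (hα : ∀ f a, TensorProduct.rid k A (f.lTensor A (ρ a)) = α f a)
    (h₁ : ∀ a, α counit a = a) (h₂ : ∀ f g a, α f (α g a) = α (conv f g) a) :
    ∃ (X : RightComodule k C) (e : A ≃ₗ[k] X.carrier), ∀ f a, X.act f (e a) = e (α f a) := by
  refine ⟨⟨A, ρ, ?_, ?_⟩, LinearEquiv.refl k A, hα⟩
  · ext a
    refine TensorProduct.eq_of_forall_rid_lTensor_map fun f g ↦ ?_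
    simp only [LinearMap.comp_apply, LinearEquiv.coe_coe]
    rw [TensorProduct.rid_lTensor_lid_map_assoc, TensorProduct.rid_lTensor_rTensor, hα, hα, h₂,
      ← hα, conv,
      ← LinearMap.lTensor_comp_apply]
  · ext a
    refine (TensorProduct.rid k A).injective ?_
    simp only [LinearMap.comp_apply]
    rw [hα, h₁]
    simp

variable (k C) in
/-- The regular right comodule. -/
noncomputable abbrev regular : RightComodule k C where
  carrier := C
  coact := comul
  coassoc := Coalgebra.coassoc
  counit_coact := by ext; simp

end RightComodule

namespace LeftComodule

/-- The right action `m · f = ∑ f(m₋₁) m₀` of functionals on a left comodule. -/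
noncomputable def act (M : LeftComodule k C) (f : C →ₗ[k] k) : M.carrier →ₗ[k] M.carrier :=
  (TensorProduct.lid k M.carrier).toLinearMap ∘ₗ f.rTensor M.carrier ∘ₗ M.coact

theorem act_apply (M : LeftComodule k C) (f : C →ₗ[k] k) (m : M.carrier) :
    M.act f m = TensorProduct.lid k M.carrier (f.rTensor M.carrier (M.coact m)) := rfl

@[simp]
theorem act_counit (M : LeftComodule k C) (m : M.carrier) : M.act counit m = m := by
  have := LinearMap.congr_fun M.counit_coact m
  simp only [LinearMap.comp_apply] at this
  rw [act_apply, this]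
  simp

theorem act_act (M : LeftComodule k C) (f g : C →ₗ[k] k) (m : M.carrier) :
    M.act g (M.act f m) = M.act (conv f g) m := by
  have := LinearMap.congr_fun M.coassoc m
  simp only [LinearMap.comp_apply, LinearEquiv.coe_coe] at this
  rw [act_apply M f, act_apply M g, ← TensorProduct.lid_rTensor_lTensor,
    ← TensorProduct.lid_rTensor_lid_map_assoc,
    ← this, LinearEquiv.symm_apply_apply, act_apply, conv,
    ← LinearMap.rTensor_comp_apply]

/-- A linear map that commutes with the actions of all functionals is a comodule morphism. -/
def homOfAct {M N : LeftComodule k C} (φ : M.carrier →ₗ[k] N.carrier)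
    (h : ∀ f m, φ (M.act f m) = N.act f (φ m)) : M ⟶ N where
  toLinearMap := φ
  comm := by
    ext m
    refine TensorProduct.eq_of_forall_lid_rTensor fun f ↦ ?_
    rw [LinearMap.comp_apply, LinearMap.comp_apply, TensorProduct.lid_rTensor_lTensor]
    exact (h f m).symm

@[simp]
theorem homOfAct_toLinearMap {M N : LeftComodule k C} (φ : M.carrier →ₗ[k] N.carrier)
    (h : ∀ f m, φ (M.act f m) = N.act f (φ m)) : (homOfAct φ h).toLinearMap = φ := rfl

theorem map_act {M N : LeftComodule k C} (φ : M ⟶ N) (f : C →ₗ[k] k) (m : M.carrier) :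
    φ.toLinearMap (M.act f m) = N.act f (φ.toLinearMap m) := by
  rw [act_apply, act_apply, ← TensorProduct.lid_rTensor_lTensor]
  exact congrArg (fun z ↦ TensorProduct.lid k _ (f.rTensor _ z))
    (LinearMap.congr_fun φ.comm m).symm

@[simp]
theorem comp_toLinearMap_apply {M N P : LeftComodule k C} (φ : M ⟶ N) (ψ : N ⟶ P)
    (m : M.carrier) : (φ ≫ ψ).toLinearMap m = ψ.toLinearMap (φ.toLinearMap m) := rfl

@[simp]
theorem id_toLinearMap_apply {M : LeftComodule k C} (m : M.carrier) :
    Hom.toLinearMap (𝟙 M) m = m := rfl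

theorem hom_ext {M N : LeftComodule k C} {φ ψ : M ⟶ N}
    (h : ∀ m, φ.toLinearMap m = ψ.toLinearMap m) : φ = ψ :=
  Hom.ext (LinearMap.ext h)

/-- The left-handed form of `RightComodule.exists_of_act`. -/
theorem exists_of_act {A : Type v} [AddCommGroup A] [Module k A] (ρ : A →ₗ[k] C ⊗[k] A)
    (α : (C →ₗ[k] k) → A → A)
    (hα : ∀ f a, TensorProduct.lid k A (f.rTensor A (ρ a)) = α f a)
    (h₁ : ∀ a, α counit a = a) (h₂ : ∀ f g a, α g (α f a) = α (conv f g) a) :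
    ∃ (X : LeftComodule k C) (e : A ≃ₗ[k] X.carrier), ∀ f a, X.act f (e a) = e (α f a) := by
  refine ⟨⟨A, ρ, ?_, ?_⟩, LinearEquiv.refl k A, hα⟩
  · ext a
    refine (TensorProduct.assoc k C C A).symm.injective
      (TensorProduct.eq_of_forall_lid_rTensor_map fun f g ↦ ?_)
    simp only [LinearMap.comp_apply, LinearEquiv.coe_coe, LinearEquiv.symm_apply_apply]
    rw [TensorProduct.lid_rTensor_lid_map_assoc, TensorProduct.lid_rTensor_lTensor, hα, hα, h₂,
      ← hα, conv,
      ← LinearMap.rTensor_comp_apply]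
  · ext a
    refine (TensorProduct.lid k A).injective ?_
    simp only [LinearMap.comp_apply]
    rw [hα, h₁]
    simp

variable (k C) in
/-- The regular left comodule. -/
noncomputable abbrev regular : LeftComodule k C where
  carrier := C
  coact := comul
  coassoc := Coalgebra.coassoc
  counit_coact := by ext; simp

end LeftComodule

/-! ### Subcomodules, quotients and factorizations -/

theorem LinearMap.exists_comp_eq_of_range_le {V W X : Type*} [AddCommGroup V] [Module k V]
    [AddCommGroup W] [Module k W] [AddCommGroup X] [Module k X] (f : V →ₗ[k] W)
    (hf : Function.Injective f) (g : X →ₗ[k] W) (h : LinearMap.range g ≤ LinearMap.range f) :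
    ∃ l : X →ₗ[k] V, ∀ x, f (l x) = g x := by
  obtain ⟨p, hp⟩ := f.exists_leftInverse_of_injective (LinearMap.ker_eq_bot.2 hf)
  refine ⟨p ∘ₗ g, fun x ↦ ?_⟩
  obtain ⟨y, hy⟩ := h ⟨x, rfl⟩
  rw [LinearMap.comp_apply, ← hy]
  exact congrArg f (LinearMap.congr_fun hp y)

theorem LinearMap.exists_comp_eq_of_ker_le {V W X : Type*} [AddCommGroup V] [Module k V]
    [AddCommGroup W] [Module k W] [AddCommGroup X] [Module k X] (f : V →ₗ[k] W)
    (hf : Function.Surjective f) (g : V →ₗ[k] X) (h : LinearMap.ker f ≤ LinearMap.ker g) :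
    ∃ l : W →ₗ[k] X, ∀ x, l (f x) = g x := by
  obtain ⟨s, hs⟩ := f.exists_rightInverse_of_surjective (LinearMap.range_eq_top.2 hf)
  refine ⟨g ∘ₗ s, fun x ↦ ?_⟩
  have hx : s (f x) - x ∈ LinearMap.ker f := by
    rw [LinearMap.mem_ker, map_sub, sub_eq_zero]
    exact LinearMap.congr_fun hs (f x)
  simpa [sub_eq_zero] using h hx

theorem LinearMap.exists_comp_eq_of_injective {V W X : Type*} [AddCommGroup V] [Module k V]
    [AddCommGroup W] [Module k W] [AddCommGroup X] [Module k X] (f : V →ₗ[k] W)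
    (hf : Function.Injective f) (g : V →ₗ[k] X) : ∃ l : W →ₗ[k] X, ∀ x, l (f x) = g x := by
  obtain ⟨p, hp⟩ := f.exists_leftInverse_of_injective (LinearMap.ker_eq_bot.2 hf)
  exact ⟨g ∘ₗ p, fun x ↦ congrArg g (LinearMap.congr_fun hp x)⟩

namespace RightComodule

theorem exists_subcomodule (M : RightComodule k C) (N : Submodule k M.carrier)
    (hN : ∀ f, ∀ n ∈ N, M.act f n ∈ N) :
    ∃ (S : RightComodule k C) (i : S ⟶ M), Function.Injective i.toLinearMap ∧
      LinearMap.range i.toLinearMap = N := by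
  -- Any linear retraction of the inclusion turns the coaction of `M` into one of `N`.
  obtain ⟨p, hp⟩ := N.subtype.exists_leftInverse_of_injective N.ker_subtype
  obtain ⟨S, e, he⟩ := exists_of_act (C := C) (p.rTensor C ∘ₗ M.coact ∘ₗ N.subtype)
    (fun f n ↦ ⟨M.act f n, hN f n n.2⟩)
    (fun f n ↦ by
      simp only [LinearMap.comp_apply]
      rw [TensorProduct.rid_lTensor_rTensor, ← act_apply]
      exact LinearMap.congr_fun hp ⟨M.act f n, hN f n n.2⟩)
    (fun n ↦ Subtype.ext (M.act_counit _))
    (fun f g n ↦ Subtype.ext (M.act_act f g _))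
  refine ⟨S, homOfAct (N.subtype ∘ₗ e.symm.toLinearMap) fun f s ↦ ?_, ?_, ?_⟩
  · obtain ⟨n, rfl⟩ := e.surjective s
    simp [he]
  · exact N.subtype_injective.comp e.symm.injective
  · rw [homOfAct_toLinearMap, LinearMap.range_comp_of_range_eq_top _ e.symm.range,
      N.range_subtype]

theorem exists_quotient (M : RightComodule k C) (N : Submodule k M.carrier)
    (hN : ∀ f, ∀ n ∈ N, M.act f n ∈ N) :
    ∃ (Q : RightComodule k C) (q : M ⟶ Q), Function.Surjective q.toLinearMap ∧
      LinearMap.ker q.toLinearMap = N := by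
  -- Any linear section of the projection turns the coaction of `M` into one of `M ⧸ N`.
  obtain ⟨s, hs⟩ := N.mkQ.exists_rightInverse_of_surjective N.range_mkQ
  have hact : ∀ f m, N.mapQ N (M.act f) (hN f) (N.mkQ m) = N.mkQ (M.act f m) := fun f m ↦ rfl
  obtain ⟨Q, e, he⟩ := exists_of_act (C := C) (N.mkQ.rTensor C ∘ₗ M.coact ∘ₗ s)
    (fun f ↦ N.mapQ N (M.act f) (hN f))
    (fun f x ↦ by
      simp only [LinearMap.comp_apply]
      rw [TensorProduct.rid_lTensor_rTensor, ← act_apply, ← hact]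
      exact congrArg _ (LinearMap.congr_fun hs x))
    (fun x ↦ by
      obtain ⟨m, rfl⟩ := N.mkQ_surjective x
      rw [hact, act_counit])
    (fun f g x ↦ by
      obtain ⟨m, rfl⟩ := N.mkQ_surjective x
      rw [hact, hact, hact, act_act])
  refine ⟨Q, homOfAct (e.toLinearMap ∘ₗ N.mkQ) fun f m ↦ ?_, ?_, ?_⟩
  · rw [LinearMap.comp_apply, LinearMap.comp_apply, ← hact]
    exact (he f _).symm
  · exact e.surjective.comp N.mkQ_surjective
  · rw [homOfAct_toLinearMap, LinearEquiv.ker_comp, N.ker_mkQ]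

theorem act_mem_ker {M N : RightComodule k C} (φ : M ⟶ N) (f : C →ₗ[k] k) (m : M.carrier)
    (hm : m ∈ LinearMap.ker φ.toLinearMap) : M.act f m ∈ LinearMap.ker φ.toLinearMap := by
  rw [LinearMap.mem_ker] at hm ⊢
  rw [map_act, hm, map_zero]

theorem act_mem_range {M N : RightComodule k C} (φ : M ⟶ N) (f : C →ₗ[k] k) (n : N.carrier)
    (hn : n ∈ LinearMap.range φ.toLinearMap) : N.act f n ∈ LinearMap.range φ.toLinearMap := by
  obtain ⟨m, rfl⟩ := hn
  exact ⟨M.act f m, map_act φ f m⟩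

theorem exists_lift {X Y W : RightComodule k C} (f : X ⟶ Y)
    (hf : Function.Injective f.toLinearMap) (g : W ⟶ Y)
    (h : LinearMap.range g.toLinearMap ≤ LinearMap.range f.toLinearMap) :
    ∃ l : W ⟶ X, l ≫ f = g := by
  obtain ⟨l, hl⟩ := f.toLinearMap.exists_comp_eq_of_range_le hf g.toLinearMap h
  exact ⟨homOfAct l fun a w ↦ hf (by rw [hl, map_act, map_act, hl]), hom_ext hl⟩

theorem exists_desc {X Y W : RightComodule k C} (f : X ⟶ Y)
    (hf : Function.Surjective f.toLinearMap) (g : X ⟶ W)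
    (h : LinearMap.ker f.toLinearMap ≤ LinearMap.ker g.toLinearMap) :
    ∃ l : Y ⟶ W, f ≫ l = g := by
  obtain ⟨l, hl⟩ := f.toLinearMap.exists_comp_eq_of_ker_le hf g.toLinearMap h
  refine ⟨homOfAct l fun a y ↦ ?_, hom_ext hl⟩
  obtain ⟨x, rfl⟩ := hf y
  rw [← map_act, hl, hl, map_act]

theorem mono_of_injective {X Y : RightComodule k C} (f : X ⟶ Y)
    (hf : Function.Injective f.toLinearMap) : Mono f :=
  ⟨fun _ _ h ↦ hom_ext fun x ↦ hf (congrArg (fun φ ↦ Hom.toLinearMap φ x) h)⟩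

theorem epi_of_surjective {X Y : RightComodule k C} (f : X ⟶ Y)
    (hf : Function.Surjective f.toLinearMap) : Epi f := by
  refine ⟨fun _ _ h ↦ hom_ext fun y ↦ ?_⟩
  obtain ⟨x, rfl⟩ := hf y
  exact congrArg (fun φ ↦ Hom.toLinearMap φ x) h

theorem injective_of_mono {X Y : RightComodule k C} (f : X ⟶ Y) [Mono f] :
    Function.Injective f.toLinearMap := by
  obtain ⟨K, i, hi, hK⟩ := X.exists_subcomodule _ (act_mem_ker f)
  have h : i = homOfAct 0 (by simp) := by
    rw [← cancel_mono f]
    refine hom_ext fun x ↦ ?_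
    have : i.toLinearMap x ∈ LinearMap.ker f.toLinearMap := hK ▸ ⟨x, rfl⟩
    simpa using this
  rw [← LinearMap.ker_eq_bot, ← hK, h, homOfAct_toLinearMap, LinearMap.range_zero]

theorem surjective_of_epi {X Y : RightComodule k C} (f : X ⟶ Y) [Epi f] :
    Function.Surjective f.toLinearMap := by
  obtain ⟨Q, q, hq, hQ⟩ := Y.exists_quotient _ (act_mem_range f)
  have h : q = homOfAct 0 (by simp) := by
    rw [← cancel_epi f]
    refine hom_ext fun x ↦ ?_
    have : f.toLinearMap x ∈ LinearMap.ker q.toLinearMap := hQ ▸ ⟨x, rfl⟩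
    simpa using this
  rw [← LinearMap.range_eq_top, ← hQ, h, homOfAct_toLinearMap, LinearMap.ker_zero]

end RightComodule

namespace LeftComodule

theorem exists_subcomodule (M : LeftComodule k C) (N : Submodule k M.carrier)
    (hN : ∀ f, ∀ n ∈ N, M.act f n ∈ N) :
    ∃ (S : LeftComodule k C) (i : S ⟶ M), Function.Injective i.toLinearMap ∧
      LinearMap.range i.toLinearMap = N := by
  obtain ⟨p, hp⟩ := N.subtype.exists_leftInverse_of_injective N.ker_subtype
  obtain ⟨S, e, he⟩ := exists_of_act (C := C) (p.lTensor C ∘ₗ M.coact ∘ₗ N.subtype)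
    (fun f n ↦ ⟨M.act f n, hN f n n.2⟩)
    (fun f n ↦ by
      simp only [LinearMap.comp_apply]
      rw [TensorProduct.lid_rTensor_lTensor, ← act_apply]
      exact LinearMap.congr_fun hp ⟨M.act f n, hN f n n.2⟩)
    (fun n ↦ Subtype.ext (M.act_counit _))
    (fun f g n ↦ Subtype.ext (M.act_act f g _))
  refine ⟨S, homOfAct (N.subtype ∘ₗ e.symm.toLinearMap) fun f s ↦ ?_, ?_, ?_⟩
  · obtain ⟨n, rfl⟩ := e.surjective s
    simp [he]
  · exact N.subtype_injective.comp e.symm.injective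
  · rw [homOfAct_toLinearMap, LinearMap.range_comp_of_range_eq_top _ e.symm.range,
      N.range_subtype]

theorem exists_quotient (M : LeftComodule k C) (N : Submodule k M.carrier)
    (hN : ∀ f, ∀ n ∈ N, M.act f n ∈ N) :
    ∃ (Q : LeftComodule k C) (q : M ⟶ Q), Function.Surjective q.toLinearMap ∧
      LinearMap.ker q.toLinearMap = N := by
  obtain ⟨s, hs⟩ := N.mkQ.exists_rightInverse_of_surjective N.range_mkQ
  have hact : ∀ f m, N.mapQ N (M.act f) (hN f) (N.mkQ m) = N.mkQ (M.act f m) := fun f m ↦ rfl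
  obtain ⟨Q, e, he⟩ := exists_of_act (C := C) (N.mkQ.lTensor C ∘ₗ M.coact ∘ₗ s)
    (fun f ↦ N.mapQ N (M.act f) (hN f))
    (fun f x ↦ by
      simp only [LinearMap.comp_apply]
      rw [TensorProduct.lid_rTensor_lTensor, ← act_apply, ← hact]
      exact congrArg _ (LinearMap.congr_fun hs x))
    (fun x ↦ by
      obtain ⟨m, rfl⟩ := N.mkQ_surjective x
      rw [hact, act_counit])
    (fun f g x ↦ by
      obtain ⟨m, rfl⟩ := N.mkQ_surjective x
      rw [hact, hact, hact, act_act])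
  refine ⟨Q, homOfAct (e.toLinearMap ∘ₗ N.mkQ) fun f m ↦ ?_, ?_, ?_⟩
  · rw [LinearMap.comp_apply, LinearMap.comp_apply, ← hact]
    exact (he f _).symm
  · exact e.surjective.comp N.mkQ_surjective
  · rw [homOfAct_toLinearMap, LinearEquiv.ker_comp, N.ker_mkQ]

theorem act_mem_ker {M N : LeftComodule k C} (φ : M ⟶ N) (f : C →ₗ[k] k) (m : M.carrier)
    (hm : m ∈ LinearMap.ker φ.toLinearMap) : M.act f m ∈ LinearMap.ker φ.toLinearMap := by
  rw [LinearMap.mem_ker] at hm ⊢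
  rw [map_act, hm, map_zero]

theorem act_mem_range {M N : LeftComodule k C} (φ : M ⟶ N) (f : C →ₗ[k] k) (n : N.carrier)
    (hn : n ∈ LinearMap.range φ.toLinearMap) : N.act f n ∈ LinearMap.range φ.toLinearMap := by
  obtain ⟨m, rfl⟩ := hn
  exact ⟨M.act f m, map_act φ f m⟩

theorem act_mem_map {M N : LeftComodule k C} (φ : M ⟶ N) {K : Submodule k M.carrier}
    (hK : ∀ f, ∀ m ∈ K, M.act f m ∈ K) (f : C →ₗ[k] k) (n : N.carrier)
    (hn : n ∈ K.map φ.toLinearMap) : N.act f n ∈ K.map φ.toLinearMap := by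
  obtain ⟨m, hm, rfl⟩ := hn
  exact ⟨M.act f m, hK f m hm, map_act φ f m⟩

theorem isSubcomodule_iff (M : LeftComodule k C) (N : Submodule k M.carrier) :
    M.IsSubcomodule N ↔ ∀ f, ∀ n ∈ N, M.act f n ∈ N := by
  refine ⟨fun h f n hn ↦ ?_, fun h n hn ↦ ?_⟩
  · obtain ⟨w, hw⟩ := h n hn
    rw [act_apply, ← hw, TensorProduct.lid_rTensor_lTensor]
    exact Subtype.property _
  · obtain ⟨S, i, -, hS⟩ := M.exists_subcomodule N h
    obtain ⟨s, rfl⟩ : n ∈ LinearMap.range i.toLinearMap := hS ▸ hn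
    have hi : ∀ s, i.toLinearMap s ∈ N := fun s ↦ hS ▸ ⟨s, rfl⟩
    refine ⟨(i.toLinearMap.codRestrict N hi).lTensor C (S.coact s), ?_⟩
    rw [← LinearMap.comp_apply, ← LinearMap.lTensor_comp, LinearMap.subtype_comp_codRestrict]
    exact (LinearMap.congr_fun i.comm s).symm

theorem exists_lift {X Y W : LeftComodule k C} (f : X ⟶ Y)
    (hf : Function.Injective f.toLinearMap) (g : W ⟶ Y)
    (h : LinearMap.range g.toLinearMap ≤ LinearMap.range f.toLinearMap) :
    ∃ l : W ⟶ X, l ≫ f = g := by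
  obtain ⟨l, hl⟩ := f.toLinearMap.exists_comp_eq_of_range_le hf g.toLinearMap h
  exact ⟨homOfAct l fun a w ↦ hf (by rw [hl, map_act, map_act, hl]), hom_ext hl⟩

theorem mono_of_injective {X Y : LeftComodule k C} (f : X ⟶ Y)
    (hf : Function.Injective f.toLinearMap) : Mono f :=
  ⟨fun _ _ h ↦ hom_ext fun x ↦ hf (congrArg (fun φ ↦ Hom.toLinearMap φ x) h)⟩

theorem injective_of_mono {X Y : LeftComodule k C} (f : X ⟶ Y) [Mono f] :
    Function.Injective f.toLinearMap := by
  obtain ⟨K, i, hi, hK⟩ := X.exists_subcomodule _ (act_mem_ker f)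
  have h : i = homOfAct 0 (by simp) := by
    rw [← cancel_mono f]
    refine hom_ext fun x ↦ ?_
    have : i.toLinearMap x ∈ LinearMap.ker f.toLinearMap := hK ▸ ⟨x, rfl⟩
    simpa using this
  rw [← LinearMap.ker_eq_bot, ← hK, h, homOfAct_toLinearMap, LinearMap.range_zero]

end LeftComodule

/-! ### Coefficient maps -/

theorem conv_eq_comp_act_left (f g : C →ₗ[k] k) :
    conv f g = g ∘ₗ (LeftComodule.regular k C).act f := by
  ext c
  change LinearMap.mul' k k (TensorProduct.map f g (comul c)) =
    g (TensorProduct.lid k C (f.rTensor C (comul c)))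
  induction comul (R := k) c with
  | zero => simp
  | add x y hx hy => simp only [map_add, hx, hy]
  | tmul a b => simp

theorem conv_eq_comp_act_right (f g : C →ₗ[k] k) :
    conv f g = f ∘ₗ (RightComodule.regular k C).act g := by
  ext c
  change LinearMap.mul' k k (TensorProduct.map f g (comul c)) =
    f (TensorProduct.rid k C (g.lTensor C (comul c)))
  induction comul (R := k) c with
  | zero => simp
  | add x y hx hy => simp only [map_add, hx, hy]
  | tmul a b => simp [mul_comm]

namespace RightComodule

/-- The coefficient map `m ↦ ∑ α(m₀) m₁` of a functional `α` on a right comodule. -/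
noncomputable def coeff (M : RightComodule k C) (α : M.carrier →ₗ[k] k) : M.carrier →ₗ[k] C :=
  (TensorProduct.lid k C).toLinearMap ∘ₗ α.rTensor C ∘ₗ M.coact

theorem apply_coeff (M : RightComodule k C) (α : M.carrier →ₗ[k] k) (f : C →ₗ[k] k)
    (m : M.carrier) : f (M.coeff α m) = α (M.act f m) := by
  simp only [coeff, act_apply, LinearMap.comp_apply, LinearEquiv.coe_coe]
  induction M.coact m with
  | zero => simp
  | add x y hx hy => simp only [map_add, hx, hy]
  | tmul a b => simp [mul_comm]

theorem coeff_act (M : RightComodule k C) (α : M.carrier →ₗ[k] k) (f : C →ₗ[k] k)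
    (m : M.carrier) : M.coeff α (M.act f m) = (regular k C).act f (M.coeff α m) :=
  Module.eq_of_forall_dual (k := k) fun g ↦ by
    rw [apply_coeff, act_act, ← apply_coeff, conv_eq_comp_act_right, LinearMap.comp_apply]

theorem coeff_map {M N : RightComodule k C} (φ : M ⟶ N) (α : N.carrier →ₗ[k] k)
    (m : M.carrier) : N.coeff α (φ.toLinearMap m) = M.coeff (α ∘ₗ φ.toLinearMap) m :=
  Module.eq_of_forall_dual (k := k) fun g ↦ by
    rw [apply_coeff, apply_coeff, LinearMap.comp_apply, map_act]

/-- Every morphism to the regular comodule is the coefficient map of its composition with the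
counit. -/
theorem coeff_counit_comp (M : RightComodule k C) (φ : M.carrier →ₗ[k] C)
    (hφ : ∀ f m, φ (M.act f m) = (regular k C).act f (φ m)) (m : M.carrier) :
    M.coeff (counit ∘ₗ φ) m = φ m :=
  Module.eq_of_forall_dual (k := k) fun g ↦ by
    rw [apply_coeff, LinearMap.comp_apply, hφ, ← LinearMap.comp_apply counit,
      ← conv_eq_comp_act_right, conv_eq_comp_act_left, LinearMap.comp_apply,
      LeftComodule.act_counit]

end RightComodule

namespace LeftComodule

/-- The coefficient map `m ↦ ∑ m₋₁ α(m₀)` of a functional `α` on a left comodule. -/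
noncomputable def coeff (M : LeftComodule k C) (α : M.carrier →ₗ[k] k) : M.carrier →ₗ[k] C :=
  (TensorProduct.rid k C).toLinearMap ∘ₗ α.lTensor C ∘ₗ M.coact

theorem apply_coeff (M : LeftComodule k C) (α : M.carrier →ₗ[k] k) (f : C →ₗ[k] k)
    (m : M.carrier) : f (M.coeff α m) = α (M.act f m) := by
  simp only [coeff, act_apply, LinearMap.comp_apply, LinearEquiv.coe_coe]
  induction M.coact m with
  | zero => simp
  | add x y hx hy => simp only [map_add, hx, hy]
  | tmul a b => simp [mul_comm]

/-- The coefficient map of a functional, as a morphism to the regular comodule. -/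
noncomputable def coeffHom (M : LeftComodule k C) (α : M.carrier →ₗ[k] k) : M ⟶ regular k C :=
  homOfAct (M.coeff α) fun f m ↦ Module.eq_of_forall_dual (k := k) fun g ↦ by
    rw [apply_coeff, act_act, ← apply_coeff, conv_eq_comp_act_left, LinearMap.comp_apply]

theorem apply_coeffHom (M : LeftComodule k C) (α : M.carrier →ₗ[k] k) (f : C →ₗ[k] k)
    (m : M.carrier) : f ((M.coeffHom α).toLinearMap m) = α (M.act f m) :=
  M.apply_coeff α f m

/-- Morphisms to the regular comodule are the coefficient maps of functionals, which extend
along injections. -/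
theorem injective_regular : Injective (regular k C) where
  factors {X Y} g f _ := by
    obtain ⟨μ, hμ⟩ := f.toLinearMap.exists_comp_eq_of_injective (injective_of_mono f)
      (counit ∘ₗ g.toLinearMap)
    refine ⟨Y.coeffHom μ, hom_ext fun x ↦ Module.eq_of_forall_dual (k := k) fun a ↦ ?_⟩
    rw [comp_toLinearMap_apply, apply_coeffHom, ← map_act, hμ, LinearMap.comp_apply, map_act,
      ← LinearMap.comp_apply counit, ← conv_eq_comp_act_left, conv_eq_comp_act_right,
      LinearMap.comp_apply, RightComodule.act_counit]

end LeftComodule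

/-! ### The abelian category of right comodules -/

namespace RightComodule

open Limits

instance (M N : RightComodule k C) : Zero (M ⟶ N) := ⟨homOfAct 0 (by simp)⟩

instance (M N : RightComodule k C) : Add (M ⟶ N) :=
  ⟨fun φ ψ ↦ homOfAct (φ.toLinearMap + ψ.toLinearMap) (by simp [map_act])⟩

instance (M N : RightComodule k C) : Neg (M ⟶ N) :=
  ⟨fun φ ↦ homOfAct (-φ.toLinearMap) (by simp [map_act])⟩

instance (M N : RightComodule k C) : Sub (M ⟶ N) :=
  ⟨fun φ ψ ↦ homOfAct (φ.toLinearMap - ψ.toLinearMap) (by simp [map_act])⟩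

instance (M N : RightComodule k C) : SMul ℕ (M ⟶ N) :=
  ⟨fun n φ ↦ homOfAct (n • φ.toLinearMap) (by simp [map_act])⟩

instance (M N : RightComodule k C) : SMul ℤ (M ⟶ N) :=
  ⟨fun n φ ↦ homOfAct (n • φ.toLinearMap) (by simp [map_act])⟩

instance (M N : RightComodule k C) : AddCommGroup (M ⟶ N) :=
  Function.Injective.addCommGroup (fun φ : M ⟶ N ↦ φ.toLinearMap) (fun _ _ h ↦ Hom.ext h)
    rfl (fun _ _ ↦ rfl) (fun _ ↦ rfl) (fun _ _ ↦ rfl) (fun _ _ ↦ rfl) (fun _ _ ↦ rfl)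

@[simp]
theorem zero_toLinearMap_apply {M N : RightComodule k C} (m : M.carrier) :
    Hom.toLinearMap (0 : M ⟶ N) m = 0 := rfl

@[simp]
theorem add_toLinearMap_apply {M N : RightComodule k C} (φ ψ : M ⟶ N) (m : M.carrier) :
    (φ + ψ).toLinearMap m = φ.toLinearMap m + ψ.toLinearMap m := rfl

instance : Preadditive (RightComodule k C) where
  add_comp _ _ _ _ _ _ := hom_ext fun _ ↦ by simp
  comp_add _ _ _ _ _ _ := hom_ext fun _ ↦ by simp

theorem comp_eq_zero_iff {M N P : RightComodule k C} (φ : M ⟶ N) (ψ : N ⟶ P) :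
    φ ≫ ψ = 0 ↔ LinearMap.range φ.toLinearMap ≤ LinearMap.ker ψ.toLinearMap := by
  refine ⟨?_, fun h ↦ hom_ext fun m ↦ h ⟨m, rfl⟩⟩
  rintro h _ ⟨m, rfl⟩
  exact congrArg (fun χ ↦ Hom.toLinearMap χ m) h

theorem nonempty_isLimit_kernelFork {K M N : RightComodule k C} (i : K ⟶ M) (φ : M ⟶ N)
    (hi : Function.Injective i.toLinearMap)
    (h : LinearMap.range i.toLinearMap = LinearMap.ker φ.toLinearMap) :
    ∃ w : i ≫ φ = 0, Nonempty (IsLimit (KernelFork.ofι i w)) := by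
  have : Mono i := mono_of_injective i hi
  have hl {W : RightComodule k C} (g : W ⟶ M) (hg : g ≫ φ = 0) : ∃ l : W ⟶ K, l ≫ i = g :=
    exists_lift i hi g (h ▸ (comp_eq_zero_iff g φ).1 hg)
  exact ⟨(comp_eq_zero_iff i φ).2 h.le, ⟨KernelFork.IsLimit.ofι' i _ fun g hg ↦
    ⟨(hl g hg).choose, (hl g hg).choose_spec⟩⟩⟩

theorem nonempty_isColimit_cokernelCofork {Q M N : RightComodule k C} (q : N ⟶ Q) (φ : M ⟶ N)
    (hq : Function.Surjective q.toLinearMap)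
    (h : LinearMap.range φ.toLinearMap = LinearMap.ker q.toLinearMap) :
    ∃ w : φ ≫ q = 0, Nonempty (IsColimit (CokernelCofork.ofπ q w)) := by
  have : Epi q := epi_of_surjective q hq
  have hl {W : RightComodule k C} (g : N ⟶ W) (hg : φ ≫ g = 0) : ∃ l : Q ⟶ W, q ≫ l = g :=
    exists_desc q hq g (h ▸ (comp_eq_zero_iff φ g).1 hg)
  exact ⟨(comp_eq_zero_iff φ q).2 h.le, ⟨CokernelCofork.IsColimit.ofπ' q _ fun g hg ↦
    ⟨(hl g hg).choose, (hl g hg).choose_spec⟩⟩⟩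

instance : HasKernels (RightComodule k C) where
  has_limit φ := by
    obtain ⟨K, i, hi, h⟩ := exists_subcomodule _ _ (act_mem_ker φ)
    obtain ⟨w, ⟨hl⟩⟩ := nonempty_isLimit_kernelFork i φ hi h
    exact ⟨⟨_, hl⟩⟩

instance : HasCokernels (RightComodule k C) where
  has_colimit φ := by
    obtain ⟨Q, q, hq, h⟩ := exists_quotient _ _ (act_mem_range φ)
    obtain ⟨w, ⟨hl⟩⟩ := nonempty_isColimit_cokernelCofork q φ hq h.symm
    exact ⟨⟨_, hl⟩⟩

instance : IsNormalMonoCategory (RightComodule k C) where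
  normalMonoOfMono φ _ := by
    obtain ⟨Q, q, hq, h⟩ := exists_quotient _ _ (act_mem_range φ)
    obtain ⟨w, ⟨hl⟩⟩ := nonempty_isLimit_kernelFork φ q (injective_of_mono φ) h.symm
    exact ⟨⟨Q, q, w, hl⟩⟩

instance : IsNormalEpiCategory (RightComodule k C) where
  normalEpiOfEpi φ _ := by
    obtain ⟨K, i, hi, h⟩ := exists_subcomodule _ _ (act_mem_ker φ)
    obtain ⟨w, ⟨hl⟩⟩ := nonempty_isColimit_cokernelCofork φ i (surjective_of_epi φ) h
    exact ⟨⟨K, i, w, hl⟩⟩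

/-- The direct sum of a family of right comodules: a comodule whose underlying space is the
direct sum, on which functionals act componentwise. -/
theorem exists_directSum {I : Type v} [DecidableEq I] (X : I → RightComodule k C) :
    ∃ (S : RightComodule k C) (e : (DirectSum I fun i ↦ (X i).carrier) ≃ₗ[k] S.carrier),
      ∀ f i x, S.act f (e (DirectSum.lof k I (fun i ↦ (X i).carrier) i x)) =
        e (DirectSum.lof k I (fun i ↦ (X i).carrier) i ((X i).act f x)) := by
  let L := DirectSum.lof k I (fun i ↦ (X i).carrier)
  let A (f : C →ₗ[k] k) : (DirectSum I fun i ↦ (X i).carrier) →ₗ[k]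
      (DirectSum I fun i ↦ (X i).carrier) := DirectSum.toModule k I _ fun i ↦ L i ∘ₗ (X i).act f
  have hA (f i x) : A f (L i x) = L i ((X i).act f x) :=
    DirectSum.toModule_lof k (φ := fun i ↦ L i ∘ₗ (X i).act f) i x
  let ρ : (DirectSum I fun i ↦ (X i).carrier) →ₗ[k] (DirectSum I fun i ↦ (X i).carrier) ⊗[k] C :=
    DirectSum.toModule k I _ fun i ↦ (L i).rTensor C ∘ₗ (X i).coact
  have hρ (i x) : ρ (L i x) = (L i).rTensor C ((X i).coact x) :=
    DirectSum.toModule_lof k (φ := fun i ↦ (L i).rTensor C ∘ₗ (X i).coact) i x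
  obtain ⟨S, e, he⟩ := exists_of_act (C := C) ρ (fun f ↦ A f)
    (fun f a ↦ by
      refine LinearMap.congr_fun (f := (TensorProduct.rid k _).toLinearMap ∘ₗ f.lTensor _ ∘ₗ ρ)
        (DirectSum.linearMap_ext k fun i ↦ LinearMap.ext fun x ↦ ?_) a
      change TensorProduct.rid k _ (f.lTensor _ (ρ (L i x))) = A f (L i x)
      rw [hρ, hA, TensorProduct.rid_lTensor_rTensor, act_apply])
    (fun a ↦ by
      refine LinearMap.congr_fun (f := A counit) (g := LinearMap.id)
        (DirectSum.linearMap_ext k fun i ↦ LinearMap.ext fun x ↦ ?_) a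
      change A counit (L i x) = L i x
      rw [hA, act_counit])
    (fun f g a ↦ by
      refine LinearMap.congr_fun (f := A f ∘ₗ A g)
        (DirectSum.linearMap_ext k fun i ↦ LinearMap.ext fun x ↦ ?_) a
      change A f (A g (L i x)) = A (conv f g) (L i x)
      rw [hA, hA, hA, act_act])
  exact ⟨S, e, fun f i x ↦ (he f _).trans (congrArg e (hA f i x))⟩

instance : HasCoproducts.{v} (RightComodule k C) := by
  classical
  intro I
  refine ⟨fun F ↦ ?_⟩
  let X : I → RightComodule k C := fun i ↦ F.obj ⟨i⟩
  obtain ⟨S, e, he⟩ := exists_directSum X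
  let ι (i : I) : X i ⟶ S :=
    homOfAct (e.toLinearMap ∘ₗ DirectSum.lof k I (fun i ↦ (X i).carrier) i)
      fun f x ↦ (he f i x).symm
  have hext {T : RightComodule k C} (a b : S.carrier →ₗ[k] T.carrier)
      (h : ∀ i x, a ((ι i).toLinearMap x) = b ((ι i).toLinearMap x)) : a = b := by
    have : a ∘ₗ e.toLinearMap = b ∘ₗ e.toLinearMap :=
      DirectSum.linearMap_ext k fun i ↦ LinearMap.ext fun x ↦ h i x
    ext s
    obtain ⟨t, rfl⟩ := e.surjective s
    exact LinearMap.congr_fun this t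
  have hdesc {T : RightComodule k C} (g : ∀ i, X i ⟶ T) : ∃ l : S ⟶ T, ∀ i, ι i ≫ l = g i := by
    let l : S.carrier →ₗ[k] T.carrier :=
      DirectSum.toModule k I _ (fun i ↦ (g i).toLinearMap) ∘ₗ e.symm.toLinearMap
    have hl (i x) : l ((ι i).toLinearMap x) = (g i).toLinearMap x := by
      simp [l, ι]
    refine ⟨homOfAct l fun f s ↦ ?_, fun i ↦ hom_ext (hl i)⟩
    refine LinearMap.congr_fun (f := l ∘ₗ S.act f) (g := T.act f ∘ₗ l)
      (hext _ _ fun i x ↦ ?_) s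
    change l (S.act f _) = T.act f (l _)
    rw [← map_act, hl, hl, map_act]
  choose d hd using @hdesc
  have hc : HasColimit (Discrete.functor (F.obj ∘ Discrete.mk)) :=
    ⟨⟨Cofan.mk S ι, Cofan.IsColimit.mk _ (fun s ↦ d s.inj) (fun s i ↦ hd s.inj i)
      fun s m hm ↦ Hom.ext (hext _ _ fun i x ↦
        congrArg (fun φ ↦ Hom.toLinearMap φ x) ((hm i).trans (hd s.inj i).symm))⟩⟩
  exact hasColimit_of_iso (Discrete.natIsoFunctor (F := F))

instance : HasFiniteProducts (RightComodule k C) :=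
  have : HasFiniteCoproducts (RightComodule k C) := hasFiniteCoproducts_of_hasCoproducts _
  have : HasFiniteBiproducts (RightComodule k C) := .of_hasFiniteCoproducts
  inferInstance

instance : Abelian (RightComodule k C) where

end RightComodule

/-! ### Cofree comodules -/

namespace RightComodule

/-- `S` is a direct sum of copies of the regular comodule indexed by `I`: the underlying space is
identified with `I →₀ C`, and functionals act componentwise. -/
def IsCofree (I : Type v) (S : RightComodule k C) (e : S.carrier ≃ₗ[k] (I →₀ C)) : Prop :=
  ∀ f s i, e (S.act f s) i = (regular k C).act f (e s i)

variable (k C) in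
theorem exists_isCofree (I : Type v) :
    ∃ (S : RightComodule k C) (e : S.carrier ≃ₗ[k] (I →₀ C)), IsCofree I S e := by
  classical
  obtain ⟨S, e, he⟩ := exists_directSum fun _ : I ↦ regular k C
  let e' : (I →₀ C) ≃ₗ[k] S.carrier := finsuppLEquivDirectSum k C I ≪≫ₗ e
  have he' (f : C →ₗ[k] k) (z : I →₀ C) :
      S.act f (e' z) = e' (Finsupp.mapRange.linearMap ((regular k C).act f) z) := by
    refine LinearMap.congr_fun (f := S.act f ∘ₗ e'.toLinearMap)
      (g := e'.toLinearMap ∘ₗ Finsupp.mapRange.linearMap ((regular k C).act f))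
      (Finsupp.lhom_ext fun i c ↦ ?_) z
    change S.act f (e (finsuppLEquivDirectSum k C I (Finsupp.single i c))) =
      e (finsuppLEquivDirectSum k C I
        (Finsupp.mapRange.linearMap ((regular k C).act f) (Finsupp.single i c)))
    rw [Finsupp.mapRange.linearMap_apply, Finsupp.mapRange_single,
      finsuppLEquivDirectSum_single, finsuppLEquivDirectSum_single]
    exact he f i c
  refine ⟨S, e'.symm, fun f s i ↦ ?_⟩
  obtain ⟨z, rfl⟩ := e'.surjective s
  rw [he', LinearEquiv.symm_apply_apply, LinearEquiv.symm_apply_apply]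
  rfl

variable {I : Type v} {S : RightComodule k C} {e : S.carrier ≃ₗ[k] (I →₀ C)}

/-- A linear map to `I →₀ k` induces a morphism to the cofree comodule, whose components are
coefficient maps. -/
theorem IsCofree.exists_hom (hS : IsCofree I S e) (M : RightComodule k C)
    (μ : M.carrier →ₗ[k] (I →₀ k)) :
    ∃ h : M ⟶ S, ∀ m i, e (h.toLinearMap m) i = M.coeff (Finsupp.lapply i ∘ₗ μ) m := by
  classical
  let h : M.carrier →ₗ[k] (I →₀ C) :=
    (TensorProduct.finsuppScalarLeft k C I).toLinearMap ∘ₗ μ.rTensor C ∘ₗ M.coact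
  have hh (m i) : h m i = M.coeff (Finsupp.lapply i ∘ₗ μ) m := by
    simp only [h, coeff, LinearMap.comp_apply, LinearEquiv.coe_coe]
    induction M.coact m with
    | zero => simp
    | add x y hx hy => simp only [map_add, Finsupp.add_apply, hx, hy]
    | tmul a c => simp
  refine ⟨homOfAct (e.symm.toLinearMap ∘ₗ h) fun f m ↦ e.injective (Finsupp.ext fun i ↦ ?_),
    fun m i ↦ by simp [hh]⟩
  rw [hS]
  simp [hh, coeff_act]

/-- Morphisms to a cofree comodule come from linear maps to `I →₀ k`, which extend along
injections. -/
theorem IsCofree.injective (hS : IsCofree I S e) : Injective S where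
  factors {X Y} g f _ := by
    obtain ⟨μ, hμ⟩ := f.toLinearMap.exists_comp_eq_of_injective (injective_of_mono f)
      (Finsupp.mapRange.linearMap counit ∘ₗ e.toLinearMap ∘ₗ g.toLinearMap)
    obtain ⟨h, hh⟩ := hS.exists_hom Y μ
    refine ⟨h, hom_ext fun x ↦ e.injective (Finsupp.ext fun i ↦ ?_)⟩
    have key : (Finsupp.lapply i ∘ₗ μ) ∘ₗ f.toLinearMap =
        counit ∘ₗ Finsupp.lapply i ∘ₗ e.toLinearMap ∘ₗ g.toLinearMap := by
      ext y
      simp [hμ]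
    rw [comp_toLinearMap_apply, hh, coeff_map, key]
    exact coeff_counit_comp X (Finsupp.lapply i ∘ₗ e.toLinearMap ∘ₗ g.toLinearMap)
      (fun f m ↦ by simp [map_act, hS f]) x

theorem IsCofree.act_symm_single (hS : IsCofree I S e) (f : C →ₗ[k] k) (i : I) (c : C) :
    S.act f (e.symm (Finsupp.single i c)) =
      e.symm (Finsupp.single i ((regular k C).act f c)) := by
  classical
  refine e.injective (Finsupp.ext fun j ↦ ?_)
  rw [hS, LinearEquiv.apply_symm_apply, LinearEquiv.apply_symm_apply, Finsupp.single_apply,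
    Finsupp.single_apply]
  split_ifs <;> simp

theorem IsCofree.exists_desc (hS : IsCofree I S e) (T : RightComodule k C)
    (g : I → (regular k C ⟶ T)) :
    ∃ l : S ⟶ T, ∀ i c, l.toLinearMap (e.symm (Finsupp.single i c)) = (g i).toLinearMap c := by
  let l : S.carrier →ₗ[k] T.carrier := Finsupp.lsum k (fun i ↦ (g i).toLinearMap) ∘ₗ e.toLinearMap
  have hl (i c) : l (e.symm (Finsupp.single i c)) = (g i).toLinearMap c := by simp [l]
  refine ⟨homOfAct l fun f s ↦ ?_, hl⟩
  obtain ⟨z, rfl⟩ := e.symm.surjective s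
  refine LinearMap.congr_fun (f := l ∘ₗ S.act f ∘ₗ e.symm.toLinearMap)
    (g := T.act f ∘ₗ l ∘ₗ e.symm.toLinearMap) (Finsupp.lhom_ext fun i c ↦ ?_) z
  change l (S.act f (e.symm (Finsupp.single i c))) = T.act f (l (e.symm (Finsupp.single i c)))
  rw [hS.act_symm_single, hl, hl, map_act]

open Limits in
theorem injective_sigma_regular (I : Type v) :
    Injective (∐ fun _ : I ↦ regular k C) := by
  obtain ⟨S, e, hS⟩ := exists_isCofree k C I
  have := hS.injective
  obtain ⟨l, hl⟩ := hS.exists_desc (∐ fun _ : I ↦ regular k C)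
    (Sigma.ι (fun _ : I ↦ regular k C))
  let ι (i : I) : regular k C ⟶ S :=
    homOfAct (e.symm.toLinearMap ∘ₗ Finsupp.lsingle i) fun f c ↦ (hS.act_symm_single f i c).symm
  have hr : Sigma.desc ι ≫ l = 𝟙 _ := Sigma.hom_ext _ _ fun i ↦ by
    rw [Sigma.ι_desc_assoc, Category.comp_id]
    exact hom_ext (hl i)
  exact (Retract.mk (Sigma.desc ι) l hr).injective

end RightComodule

namespace LeftComodule

theorem coact_injective (M : LeftComodule k C) : Function.Injective M.coact := by
  intro x y h
  rw [← M.act_counit x, ← M.act_counit y, act_apply, act_apply, h]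

/-- The cofree left comodule `C ⊗ M`. -/
theorem exists_cofree (M : LeftComodule k C) :
    ∃ (S : LeftComodule k C) (e : (C ⊗[k] M.carrier) ≃ₗ[k] S.carrier),
      ∀ f z, S.act f (e z) = e (((regular k C).act f).rTensor M.carrier z) := by
  refine exists_of_act
    ((TensorProduct.assoc k C C M.carrier).toLinearMap ∘ₗ (comul (R := k)).rTensor M.carrier)
    (fun f ↦ ((regular k C).act f).rTensor M.carrier) (fun f z ↦ ?_) (fun z ↦ ?_)
    (fun f g z ↦ ?_)
  · induction z with
    | zero => simp
    | add x y hx hy => simp only [map_add, hx, hy]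
    | tmul c m =>
      change TensorProduct.lid k _ (f.rTensor _ (TensorProduct.assoc k C C M.carrier
        (comul c ⊗ₜ m))) = (TensorProduct.lid k C (f.rTensor C (comul c))) ⊗ₜ m
      induction comul (R := k) c with
      | zero => simp
      | add x y hx hy => simp only [map_add, add_tmul, hx, hy]
      | tmul a b => simp [smul_tmul']
  · have : (regular k C).act counit = LinearMap.id := LinearMap.ext (act_counit _)
    rw [this, LinearMap.rTensor_id, LinearMap.id_apply]
  · have : (regular k C).act g ∘ₗ (regular k C).act f = (regular k C).act (conv f g) :=
      LinearMap.ext (act_act _ f g)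
    rw [← LinearMap.rTensor_comp_apply, this]

/-- An injective left comodule is a retract of the cofree comodule on its underlying space. -/
theorem exists_retraction_coact (M : LeftComodule k C) [Injective M] :
    ∃ r : C ⊗[k] M.carrier →ₗ[k] M.carrier, (∀ m, r (M.coact m) = m) ∧
      ∀ f z, r (((regular k C).act f).rTensor M.carrier z) = M.act f (r z) := by
  obtain ⟨S, e, he⟩ := M.exists_cofree
  have hact (f m) : M.coact (M.act f m) =
      ((regular k C).act f).rTensor M.carrier (M.coact m) := by
    refine TensorProduct.eq_of_forall_lid_rTensor fun g ↦ ?_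
    rw [← act_apply, act_act, ← LinearMap.rTensor_comp_apply, ← conv_eq_comp_act_left, act_apply]
  let i : M ⟶ S := homOfAct (e.toLinearMap ∘ₗ M.coact) fun f m ↦ by
    simp [he, hact]
  have : Mono i := mono_of_injective i (e.injective.comp M.coact_injective)
  let r : S ⟶ M := Injective.factorThru (𝟙 M) i
  refine ⟨r.toLinearMap ∘ₗ e.toLinearMap, fun m ↦ ?_, fun f z ↦ ?_⟩
  · exact congrArg (fun φ ↦ Hom.toLinearMap φ m) (Injective.comp_factorThru (𝟙 M) i)
  · simp [← he, map_act]

/-! ### The dual of a finite-dimensional left comodule -/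

/-- The dual of a finite-dimensional left comodule is a right comodule. It is carried by the space
of the comodule itself, identified with its dual by a basis, as the dual space lives in another
universe. -/
theorem exists_dual (E : LeftComodule k C) [FiniteDimensional k E.carrier] :
    ∃ (X : RightComodule k C) (D : X.carrier ≃ₗ[k] Module.Dual k E.carrier),
      ∀ f x m, D (X.act f x) m = D x (E.act f m) := by
  let b := Module.finBasis k E.carrier
  let D := b.toDualEquiv
  let ρ : E.carrier →ₗ[k] E.carrier ⊗[k] C :=
    ∑ j, TensorProduct.mk k _ _ (D.symm (b.coord j)) ∘ₗ
      { toFun := fun x ↦ E.coeff (D x) (b j)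
        map_add' := fun x y ↦ Module.eq_of_forall_dual (k := k) fun f ↦ by
          simp [apply_coeff]
        map_smul' := fun a x ↦ Module.eq_of_forall_dual (k := k) fun f ↦ by
          simp [apply_coeff] }
  have hsum (α : Module.Dual k E.carrier) : ∑ j, α (b j) • b.coord j = α :=
    b.ext fun i ↦ by simp
  obtain ⟨X, e, he⟩ := RightComodule.exists_of_act (C := C) ρ
    (fun f x ↦ D.symm (D x ∘ₗ E.act f))
    (fun f x ↦ D.injective <| by
      rw [LinearEquiv.apply_symm_apply, ← hsum (D x ∘ₗ E.act f)]
      simp [ρ, apply_coeff])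
    (fun x ↦ D.injective <| by ext; simp)
    (fun f g x ↦ D.injective <| by ext; simp [act_act])
  refine ⟨X, e.symm ≪≫ₗ D, fun f x m ↦ ?_⟩
  obtain ⟨y, rfl⟩ := e.surjective x
  simp [he]

/-- The dual of a finite-dimensional injective left comodule is a projective right comodule. -/
theorem projective_dual (E : LeftComodule k C) [FiniteDimensional k E.carrier] [Injective E]
    (X : RightComodule k C) (D : X.carrier ≃ₗ[k] Module.Dual k E.carrier)
    (hD : ∀ f x m, D (X.act f x) m = D x (E.act f m)) : Projective X where
  factors {A B} g p _ := by
    obtain ⟨r, hr, hract⟩ := E.exists_retraction_coact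
    obtain ⟨s, hs⟩ := p.toLinearMap.exists_rightInverse_of_surjective
      (LinearMap.range_eq_top.2 (RightComodule.surjective_of_epi p))
    let b := Module.finBasis k E.carrier
    let β (x : X.carrier) (j) : C →ₗ[k] k :=
      D x ∘ₗ r ∘ₗ (TensorProduct.mk k C E.carrier).flip (b j)
    have hβ (f x j) : β (X.act f x) j = conv f (β x j) := by
      rw [conv_eq_comp_act_left]
      ext c
      simp only [β, LinearMap.comp_apply, LinearMap.flip_apply, TensorProduct.mk_apply]
      rw [hD, ← hract, LinearMap.rTensor_tmul]
    -- The linear lift `s ∘ g` is averaged by means of the retraction `r`.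
    let h : X.carrier →ₗ[k] A.carrier :=
      { toFun := fun x ↦ ∑ j, A.act (β x j) (s (g.toLinearMap (D.symm (b.coord j))))
        map_add' := fun x y ↦ by
          simp [β, LinearMap.add_comp, Finset.sum_add_distrib]
        map_smul' := fun a x ↦ by
          simp [β, LinearMap.smul_comp, Finset.smul_sum] }
    have hβsum (x : X.carrier) : ∑ j, X.act (β x j) (D.symm (b.coord j)) = x := by
      refine D.injective (LinearMap.ext fun m ↦ ?_)
      have (z : C ⊗[k] E.carrier) : ∑ j, b.coord j
          (TensorProduct.lid k _ ((β x j).rTensor _ z)) = D x (r z) := by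
        induction z with
        | zero => simp
        | add x y hx hy => simp only [map_add, Finset.sum_add_distrib, hx, hy]
        | tmul c e =>
          conv_rhs => rw [← b.sum_repr e, tmul_sum, map_sum, map_sum]
          simp [β, mul_comm]
      rw [map_sum, LinearMap.sum_apply, ← hr m, ← this, hr]
      exact Finset.sum_congr rfl fun j _ ↦ by
        rw [hD, LinearEquiv.apply_symm_apply, act_apply]
    refine ⟨RightComodule.homOfAct h fun f x ↦ ?_, RightComodule.hom_ext fun x ↦ ?_⟩
    · simp [h, hβ, RightComodule.act_act]
    · have hs' (y) : p.toLinearMap (s y) = y := LinearMap.congr_fun hs y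
      conv_rhs => rw [← hβsum x]
      simp [h, RightComodule.map_act, hs']

end LeftComodule

/-! ### Generators of the category of right comodules -/

namespace RightComodule

open Limits

/-- A map `B` from a right comodule `X` to the dual of `C` that is linear over the convolution
algebra turns every element `m` of a right comodule `M` into a morphism
`x ↦ ∑ m₀ B(x)(m₁)` from `X` to `M`. -/
noncomputable def pairingHom {X : RightComodule k C} (B : X.carrier →ₗ[k] C →ₗ[k] k)
    (hB : ∀ f x, B (X.act f x) = conv f (B x)) (M : RightComodule k C) (m : M.carrier) : X ⟶ M :=
  homOfAct
    { toFun := fun x ↦ M.act (B x) m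
      map_add' := fun x y ↦ by simp
      map_smul' := fun a x ↦ by simp }
    fun f x ↦ by
      change M.act (B (X.act f x)) m = M.act f (M.act (B x) m)
      rw [hB, act_act]

theorem pairingHom_apply {X : RightComodule k C} (B : X.carrier →ₗ[k] C →ₗ[k] k)
    (hB : ∀ f x, B (X.act f x) = conv f (B x)) (M : RightComodule k C) (m : M.carrier)
    (x : X.carrier) : (pairingHom B hB M m).toLinearMap x = M.act (B x) m := rfl

/-- Comodules whose pairings with `C` jointly separate the points of `C` generate the category of
right comodules: a functional `α` that vanishes on `∑ m₀ B(x)(m₁)` for all `B` and `x` has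
coefficient `∑ α(m₀) m₁` orthogonal to all `x`, so that this coefficient is zero, and its counit
`α(m)` is too. -/
theorem exists_epi_of_pairing {J : Type v} (X : J → RightComodule k C)
    (B : ∀ j, (X j).carrier →ₗ[k] C →ₗ[k] k)
    (hB : ∀ j f x, B j ((X j).act f x) = conv f (B j x))
    (hsep : ∀ c : C, c ≠ 0 → ∃ j x, B j x c ≠ 0) (M : RightComodule k C) :
    ∃ (I : Type v) (σ : I → J) (π : (∐ fun i ↦ X (σ i)) ⟶ M), Epi π := by
  refine ⟨J × M.carrier, Prod.fst,
    Sigma.desc fun p ↦ pairingHom (B p.1) (hB p.1) M p.2, ⟨fun {Z} a b hab ↦ ?_⟩⟩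
  refine hom_ext fun m ↦ Module.eq_of_forall_dual (k := k) fun α ↦ ?_
  have h (j) (x : (X j).carrier) : a.toLinearMap (M.act (B j x) m) =
      b.toLinearMap (M.act (B j x) m) := by
    have := congrArg (fun φ ↦ Hom.toLinearMap (Sigma.ι (fun p : J × M.carrier ↦ X p.1) (j, m) ≫ φ)
      x) hab
    simpa only [Sigma.ι_desc_assoc, comp_toLinearMap_apply, pairingHom_apply] using this
  have hc : M.coeff (α ∘ₗ a.toLinearMap - α ∘ₗ b.toLinearMap) m = 0 := by
    by_contra hne
    obtain ⟨j, x, hx⟩ := hsep _ hne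
    rw [apply_coeff] at hx
    exact hx (by simp [h])
  have := apply_coeff M (α ∘ₗ a.toLinearMap - α ∘ₗ b.toLinearMap) counit m
  rw [hc, map_zero, act_counit] at this
  exact (sub_eq_zero.1 this.symm)

end RightComodule

/-! ### Simple subcomodules and injective envelopes -/

namespace LeftComodule

/-- The map `f ↦ m · f` for an element `m` of a left comodule. -/
noncomputable def orbitMap (M : LeftComodule k C) (m : M.carrier) : (C →ₗ[k] k) →ₗ[k] M.carrier :=
  (TensorProduct.lid k M.carrier).toLinearMap ∘ₗ LinearMap.applyₗ (M.coact m) ∘ₗ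
    LinearMap.rTensorHom (R := k) (M := M.carrier) (N := C) (P := k)

/-- The subcomodule of a left comodule generated by one element. -/
noncomputable def orbit (M : LeftComodule k C) (m : M.carrier) : Submodule k M.carrier :=
  LinearMap.range (M.orbitMap m)

theorem mem_orbit {M : LeftComodule k C} {m n : M.carrier} :
    n ∈ M.orbit m ↔ ∃ f, M.act f m = n := Iff.rfl

theorem finiteDimensional_orbit (M : LeftComodule k C) (m : M.carrier) :
    FiniteDimensional k (M.orbit m) :=
  TensorProduct.finiteDimensional_range_of_lid_rTensor _

/-- The subcomodule generated by a nonzero element contains a simple one, as it has finite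
dimension. -/
theorem exists_isSimple (M : LeftComodule k C) (m : M.carrier) (hm : m ≠ 0) :
    ∃ (T : LeftComodule k C) (i : T ⟶ M), T.IsSimple ∧ Function.Injective i.toLinearMap ∧
      LinearMap.range i.toLinearMap ≤ M.orbit m := by
  let P : Set (Submodule k M.carrier) :=
    {K | K ≠ ⊥ ∧ (∀ f, ∀ n ∈ K, M.act f n ∈ K) ∧ K ≤ M.orbit m}
  have hP : P.Nonempty := by
    refine ⟨M.orbit m, fun h ↦ hm ?_, ?_, le_rfl⟩
    · rw [← Submodule.mem_bot k, ← h]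
      exact mem_orbit.2 ⟨counit, M.act_counit m⟩
    · rintro f _ ⟨g, rfl⟩
      exact mem_orbit.2 ⟨conv g f, (M.act_act g f m).symm⟩
  obtain ⟨K, ⟨hK0, hK, hKm⟩, hmin⟩ :=
    (InvImage.wf (fun K : Submodule k M.carrier ↦ Module.finrank k K) wellFounded_lt).has_min P hP
  have := M.finiteDimensional_orbit m
  have hfin : FiniteDimensional k K := Submodule.finiteDimensional_of_le hKm
  obtain ⟨T, i, hi, hiK⟩ := M.exists_subcomodule K hK
  refine ⟨T, i, ⟨?_, fun N hN ↦ ?_⟩, hi, hiK ▸ hKm⟩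
  · rw [← not_subsingleton_iff_nontrivial]
    refine fun _ ↦ hK0 ?_
    rw [← hiK, LinearMap.range_eq_bot]
    exact Subsingleton.elim _ _
  · rw [isSubcomodule_iff] at hN
    by_cases h : N = ⊥
    · exact Or.inl h
    have hle : N.map i.toLinearMap ≤ K := hiK ▸ LinearMap.map_le_range
    have hmem : N.map i.toLinearMap ∈ P := by
      refine ⟨fun h' ↦ h ?_, act_mem_map i hN, hle.trans hKm⟩
      exact Submodule.map_injective_of_injective hi (h'.trans (Submodule.map_bot _).symm)
    have heq : N.map i.toLinearMap = K :=
      Submodule.eq_of_le_of_finrank_le hle (not_lt.1 (hmin _ hmem))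
    refine Or.inr (Submodule.map_injective_of_injective hi ?_)
    rw [heq, Submodule.map_top, hiK]

theorem IsSimple.injective {S M : LeftComodule k C} (hS : S.IsSimple) (φ : S ⟶ M) (s : S.carrier)
    (hs : φ.toLinearMap s ≠ 0) : Function.Injective φ.toLinearMap := by
  refine LinearMap.ker_eq_bot.1 ((hS.2 _ ((isSubcomodule_iff _ _).2 (act_mem_ker φ))).resolve_right
    fun h ↦ hs ?_)
  rw [← LinearMap.mem_ker, h]
  exact Submodule.mem_top

/-- If a subobject `j : S ⟶ Q` of an injective comodule is mapped injectively by an endomorphism of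
`Q` of finite rank, then it has a finite-dimensional injective envelope. -/
theorem exists_isInjectiveEnvelope {S Q : LeftComodule k C} [Injective Q] (j : S ⟶ Q)
    (hj : Function.Injective j.toLinearMap) (ψ : Q ⟶ Q)
    (hψ : FiniteDimensional k (LinearMap.range ψ.toLinearMap))
    (hjψ : Function.Injective (j ≫ ψ).toLinearMap) :
    ∃ (E : LeftComodule k C) (i : S ⟶ E), IsInjectiveEnvelope i ∧
      FiniteDimensional k E.carrier := by
  let P : Set (Q ⟶ Q) := {ψ | FiniteDimensional k (LinearMap.range ψ.toLinearMap) ∧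
    Function.Injective (j ≫ ψ).toLinearMap}
  obtain ⟨ψ, ⟨hψ, hjψ⟩, hmin⟩ := (InvImage.wf (fun ψ : Q ⟶ Q ↦
    Module.finrank k (LinearMap.range ψ.toLinearMap)) wellFounded_lt).has_min P ⟨ψ, hψ, hjψ⟩
  have := mono_of_injective _ hjψ
  have := mono_of_injective _ hj
  -- Among the endomorphisms of minimal rank that are injective on `S`, `η` is the identity on `S`.
  let η : Q ⟶ Q := ψ ≫ Injective.factorThru j (j ≫ ψ)
  have hjη : j ≫ η = j := by
    rw [← Category.assoc, Injective.comp_factorThru]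
  have hrange (α β : Q ⟶ Q) : LinearMap.range (α ≫ β).toLinearMap =
      (LinearMap.range α.toLinearMap).map β.toLinearMap := LinearMap.range_comp _ _
  have hη : FiniteDimensional k (LinearMap.range η.toLinearMap) := by
    rw [hrange]
    infer_instance
  have hle : Module.finrank k (LinearMap.range η.toLinearMap) ≤
      Module.finrank k (LinearMap.range ψ.toLinearMap) := by
    rw [hrange]
    exact Submodule.finrank_map_le _ _
  -- By minimality, `η ≫ ω` has the rank of `η` whenever it is injective on `S`.
  have key (ω : Q ⟶ Q) (hω : Function.Injective (j ≫ η ≫ ω).toLinearMap) (y : Q.carrier)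
      (hy : y ∈ LinearMap.range η.toLinearMap) (hωy : ω.toLinearMap y = 0) : y = 0 := by
    have hfin : FiniteDimensional k (LinearMap.range (η ≫ ω).toLinearMap) := by
      rw [hrange]
      infer_instance
    have h₁ : Module.finrank k (LinearMap.range ψ.toLinearMap) ≤
        Module.finrank k (LinearMap.range (η ≫ ω).toLinearMap) :=
      not_lt.1 (hmin (η ≫ ω) ⟨hfin, hω⟩)
    rw [hrange, ← LinearMap.range_domRestrict] at h₁
    have h₂ := (ω.toLinearMap.domRestrict
      (LinearMap.range η.toLinearMap)).finrank_range_add_finrank_ker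
    have h₃ : LinearMap.ker (ω.toLinearMap.domRestrict (LinearMap.range η.toLinearMap)) = ⊥ :=
      Submodule.finrank_eq_zero.1 (by omega)
    exact congrArg Subtype.val (LinearMap.ker_eq_bot'.1 h₃ ⟨y, hy⟩ hωy)
  obtain ⟨E, ι, hι, hιη⟩ := Q.exists_subcomodule _ (act_mem_range η)
  have hEfin : FiniteDimensional k E.carrier :=
    have : FiniteDimensional k (LinearMap.range ι.toLinearMap) := hιη ▸ hη
    (LinearEquiv.ofInjective ι.toLinearMap hι).symm.finiteDimensional
  have := mono_of_injective ι hι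
  obtain ⟨π, hπ⟩ := exists_lift ι hι η hιη.ge
  have hτ : Function.Injective (ι ≫ π).toLinearMap := by
    refine LinearMap.ker_eq_bot.1 (LinearMap.ker_eq_bot'.2 fun x hx ↦ hι ?_)
    rw [map_zero]
    refine key η (by rwa [← Category.assoc, hjη, hjη]) _ (hιη ▸ ⟨x, rfl⟩) ?_
    rw [← hπ]
    change ι.toLinearMap ((ι ≫ π).toLinearMap x) = 0
    rw [hx, map_zero]
  have := mono_of_injective _ hτ
  obtain ⟨σ, hσ⟩ := exists_lift (ι ≫ π) hτ (𝟙 E)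
    (by rw [LinearMap.range_eq_top.2 (LinearMap.injective_iff_surjective.1 hτ)]; exact le_top)
  have hr : ι ≫ π ≫ σ = 𝟙 E := by
    rw [← cancel_mono (ι ≫ π), Category.assoc, Category.assoc, hσ, Category.comp_id,
      Category.id_comp]
  have hjι : (j ≫ π) ≫ ι = j := by rw [Category.assoc, hπ, hjη]
  have hjι' (s) : ι.toLinearMap ((j ≫ π).toLinearMap s) = j.toLinearMap s :=
    congrArg (fun φ ↦ Hom.toLinearMap φ s) hjι
  refine ⟨E, j ≫ π, ⟨(Retract.mk ι (π ≫ σ) hr).injective, ?_, fun N hN hN0 hbot ↦ hN0 ?_⟩, hEfin⟩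
  · intro x y hxy
    exact hj (by rw [← hjι', hxy, hjι'])
  · rw [isSubcomodule_iff] at hN
    obtain ⟨R, q, hq, hqN⟩ := Q.exists_quotient _ (act_mem_map ι hN)
    -- A subcomodule `N` meeting `S` trivially is killed by an endomorphism fixing `S`.
    have hjq : Function.Injective (j ≫ q).toLinearMap := by
      refine LinearMap.ker_eq_bot.1 (LinearMap.ker_eq_bot'.2 fun s hs ↦ ?_)
      obtain ⟨n, hn, hns⟩ : j.toLinearMap s ∈ N.map ι.toLinearMap := hqN ▸ hs
      have hsn : n = (j ≫ π).toLinearMap s := hι (by rw [hns, hjι'])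
      have : n ∈ N ⊓ LinearMap.range (j ≫ π).toLinearMap := ⟨hn, s, hsn.symm⟩
      rw [hbot, Submodule.mem_bot] at this
      exact hj (by rw [← hns, this, map_zero, map_zero])
    have := mono_of_injective _ hjq
    let ω : Q ⟶ Q := q ≫ Injective.factorThru j (j ≫ q)
    have hω : j ≫ ω = j := by
      rw [← Category.assoc, Injective.comp_factorThru]
    refine (Submodule.eq_bot_iff _).2 fun n hn ↦ hι ?_
    rw [map_zero]
    refine key ω (by rwa [← Category.assoc, hjη, hω]) _ (hιη ▸ ⟨n, rfl⟩) ?_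
    have : ι.toLinearMap n ∈ LinearMap.ker q.toLinearMap := hqN ▸ ⟨n, hn, rfl⟩
    change (Injective.factorThru j (j ≫ q)).toLinearMap (q.toLinearMap _) = 0
    rw [this, map_zero]

end LeftComodule

/-! ### Quasi-co-Frobenius coalgebras -/

theorem ofConv_mul_eq_conv (f g : WithConv (C →ₗ[k] k)) :
    (f * g).ofConv = conv f.ofConv g.ofConv := rfl

theorem rightHit_eq_act (c : C) (f : WithConv (C →ₗ[k] k)) :
    rightHit c f = (LeftComodule.regular k C).act f.ofConv c := rfl

theorem counit_act_left (f : C →ₗ[k] k) (c : C) :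
    counit (R := k) ((LeftComodule.regular k C).act f c) = f c := by
  rw [← LinearMap.comp_apply counit, ← conv_eq_comp_act_left, conv_eq_comp_act_right,
    LinearMap.comp_apply, RightComodule.act_counit]

/-- A right linear map `θ : C → C*` with `θ(x)(c) ≠ 0` yields the endomorphism
`y ↦ c ↼ θ(y)` of the left comodule `C`, whose image lies in the finite-dimensional `c ↼ C*`. -/
theorem IsRightQcF.exists_hom (h : IsRightQcF k C) (x : C) (hx : x ≠ 0) :
    ∃ ψ : LeftComodule.regular k C ⟶ LeftComodule.regular k C,
      FiniteDimensional k (LinearMap.range ψ.toLinearMap) ∧ ψ.toLinearMap x ≠ 0 := by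
  obtain ⟨I, φ, hφ, hmul⟩ := h
  obtain ⟨i, hi⟩ := Function.ne_iff.1 ((map_ne_zero_iff φ hφ).2 hx)
  obtain ⟨c, hc⟩ : ∃ c, (φ x i).ofConv c ≠ 0 := by
    by_contra! h0
    exact hi (WithConv.ext (LinearMap.ext h0))
  let ψ : C →ₗ[k] C := (LeftComodule.regular k C).orbitMap c ∘ₗ
    (WithConv.linearEquiv k (C →ₗ[k] k)).toLinearMap ∘ₗ LinearMap.proj i ∘ₗ φ
  have hψ (y) : ψ y = (LeftComodule.regular k C).act (φ y i).ofConv c := rfl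
  refine ⟨LeftComodule.homOfAct ψ fun f y ↦ ?_, ?_, fun h0 ↦ hc ?_⟩
  · rw [hψ, hψ, LeftComodule.act_act]
    have := congrArg WithConv.ofConv (hmul y (WithConv.toConv f) i)
    rw [rightHit_eq_act, ofConv_mul_eq_conv] at this
    exact congrArg (fun g ↦ (LeftComodule.regular k C).act g c) this
  · have := (LeftComodule.regular k C).finiteDimensional_orbit c
    exact Submodule.finiteDimensional_of_le (S₂ := (LeftComodule.regular k C).orbit c)
      (LinearMap.range_comp_le_range _ _)
  · rw [← counit_act_left, ← hψ]
    exact (congrArg _ h0).trans (map_zero _)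

/-- A simple left comodule embeds in `C` by a coefficient map. -/
theorem IsRightQcF.isRightSemiperfect (h : IsRightQcF k C) : IsRightSemiperfect k C := by
  intro S hS
  have := hS.1
  obtain ⟨s, hs⟩ := exists_ne (0 : S.carrier)
  obtain ⟨α, hα⟩ : ∃ α : S.carrier →ₗ[k] k, α s ≠ 0 := by
    by_contra! h0
    exact hs ((Module.forall_dual_apply_eq_zero_iff k s).1 h0)
  have hjs : (S.coeffHom α).toLinearMap s ≠ 0 := fun h0 ↦ hα <| by
    rw [← S.act_counit s, ← LeftComodule.apply_coeffHom, h0, map_zero]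
  obtain ⟨ψ, hψ, hψs⟩ := h.exists_hom _ hjs
  have := LeftComodule.injective_regular (k := k) (C := C)
  exact LeftComodule.exists_isInjectiveEnvelope (S.coeffHom α) (hS.injective _ s hjs) ψ hψ
    (hS.injective _ s hψs)

/-- Over a quasi-co-Frobenius coalgebra `C`, the regular comodule is a generator, so that every
projective comodule is a retract of a direct sum of copies of `C`, which is cofree. -/
theorem IsRightQcF.injective_of_projective (h : IsRightQcF k C) (P : RightComodule k C)
    [Projective P] : Injective P := by
  obtain ⟨I, φ, hφ, hmul⟩ := h
  obtain ⟨J, σ, π, hπ⟩ := RightComodule.exists_epi_of_pairing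
    (fun _ : I ↦ RightComodule.regular k C)
    (fun i ↦ ((WithConv.linearEquiv k (C →ₗ[k] k)).toLinearMap ∘ₗ LinearMap.proj i ∘ₗ φ).flip)
    (fun i f c ↦ by
      ext x
      rw [conv_eq_comp_act_left]
      have := congrArg (fun g ↦ g.ofConv c) (hmul x (WithConv.toConv f) i)
      rw [rightHit_eq_act, ofConv_mul_eq_conv, conv_eq_comp_act_right] at this
      exact this.symm)
    (fun x hx ↦ by
      obtain ⟨i, hi⟩ := Function.ne_iff.1 ((map_ne_zero_iff φ hφ).2 hx)
      by_contra! h0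
      exact hi (WithConv.ext (LinearMap.ext (h0 i))))
    P
  have := RightComodule.injective_sigma_regular (k := k) (C := C) J
  exact (Retract.mk (Projective.factorThru (𝟙 P) π) π (Projective.factorThru_comp _ _)).injective

/-- The embedding of a simple subcomodule of `c ↼ C*` in its envelope extends to a morphism defined
on `C`. It cannot vanish at `c`. -/
theorem IsRightSemiperfect.exists_hom (h : IsRightSemiperfect k C) (c : C) (hc : c ≠ 0) :
    ∃ (E : LeftComodule k C) (g : LeftComodule.regular k C ⟶ E), Injective E ∧
      FiniteDimensional k E.carrier ∧ g.toLinearMap c ≠ 0 := by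
  obtain ⟨T, i, hT, hi, hic⟩ := (LeftComodule.regular k C).exists_isSimple c hc
  obtain ⟨E, j, ⟨hE, hj, -⟩, hfin⟩ := h T hT
  have := LeftComodule.mono_of_injective i hi
  refine ⟨E, Injective.factorThru j i, hE, hfin, fun h0 ↦ ?_⟩
  have := hT.1
  obtain ⟨t, ht⟩ := exists_ne (0 : T.carrier)
  obtain ⟨f, hf⟩ := LeftComodule.mem_orbit.1 (hic ⟨t, rfl⟩)
  refine ht (hj ?_)
  rw [map_zero, ← Injective.comp_factorThru j i, LeftComodule.comp_toLinearMap_apply, ← hf,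
    LeftComodule.map_act, h0, map_zero]

/-- The duals of the comodules `E` of `IsRightSemiperfect.exists_hom` are projective generators. -/
theorem IsRightSemiperfect.enoughProjectives (h : IsRightSemiperfect k C) :
    EnoughProjectives (RightComodule k C) where
  presentation M := by
    choose E g hE hfin hg using fun c : {c : C // c ≠ 0} ↦ h.exists_hom c.1 c.2
    choose X D hD using fun c ↦ (E c).exists_dual
    have hX (c) : Projective (X c) := (E c).projective_dual (X c) (D c) (hD c)
    obtain ⟨J, σ, π, hπ⟩ := RightComodule.exists_epi_of_pairing X
      (fun c ↦ LinearMap.lcomp k k (g c).toLinearMap ∘ₗ (D c).toLinearMap)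
      (fun c f x ↦ by
        rw [conv_eq_comp_act_left]
        ext y
        change D c ((X c).act f x) ((g c).toLinearMap y) =
          D c x ((g c).toLinearMap ((LeftComodule.regular k C).act f y))
        rw [hD, LeftComodule.map_act])
      (fun c hc ↦ by
        by_contra! h0
        refine hg ⟨c, hc⟩ ((Module.forall_dual_apply_eq_zero_iff k _).1 fun α ↦ ?_)
        obtain ⟨x, rfl⟩ := (D ⟨c, hc⟩).surjective α
        exact h0 ⟨c, hc⟩ x) M
    exact ⟨{ p := Limits.sigmaObj fun i ↦ X (σ i), f := π }⟩

/-- If the dual `X` of the finite-dimensional injective left comodule `E` is injective, it is a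
retract of a direct sum of copies of `C`, and the transposes of the components `C → X` of the
retraction jointly embed `E` in a power of `C*`. -/
theorem IsRightSemiperfect.exists_linear (h : IsRightSemiperfect k C)
    (hinj : ∀ P : RightComodule k C, Projective P → Injective P) (c : C) (hc : c ≠ 0) :
    ∃ θ : C →ₗ[k] C →ₗ[k] k, θ c ≠ 0 ∧
      ∀ f y, θ ((LeftComodule.regular k C).act f y) = conv (θ y) f := by
  obtain ⟨E, g, hE, hfin, hg⟩ := h.exists_hom c hc
  obtain ⟨X, D, hD⟩ := E.exists_dual
  have := hinj X (E.projective_dual X D hD)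
  let b := Module.Free.chooseBasis k X.carrier
  obtain ⟨S, e, hS⟩ := RightComodule.exists_isCofree k C (Module.Free.ChooseBasisIndex k X.carrier)
  obtain ⟨l, hl⟩ := hS.exists_hom X b.repr.toLinearMap
  have : Mono l := by
    refine RightComodule.mono_of_injective l fun x y hxy ↦ b.repr.injective (Finsupp.ext fun i ↦ ?_)
    have h₁ := hl x i
    rw [hxy, hl] at h₁
    have h₂ := congrArg (counit (R := k)) h₁
    rw [RightComodule.apply_coeff, RightComodule.apply_coeff, RightComodule.act_counit,
      RightComodule.act_counit] at h₂
    exact h₂.symm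
  let r : S ⟶ X := Injective.factorThru (𝟙 X) l
  have hr (x) : r.toLinearMap (l.toLinearMap x) = x :=
    congrArg (fun φ ↦ RightComodule.Hom.toLinearMap φ x) (Injective.comp_factorThru (𝟙 X) l)
  let θ (i) : C →ₗ[k] C →ₗ[k] k :=
    (D.toLinearMap ∘ₗ r.toLinearMap ∘ₗ e.symm.toLinearMap ∘ₗ Finsupp.lsingle i).flip ∘ₗ
      g.toLinearMap
  obtain ⟨i, hi⟩ : ∃ i, θ i c ≠ 0 := by
    by_contra! h0
    refine hg ((Module.forall_dual_apply_eq_zero_iff k _).1 fun α ↦ ?_)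
    obtain ⟨x, rfl⟩ := D.surjective α
    rw [← hr x, ← e.symm_apply_apply (l.toLinearMap x)]
    refine LinearMap.congr_fun (f := LinearMap.applyₗ (g.toLinearMap c) ∘ₗ D.toLinearMap ∘ₗ
      r.toLinearMap ∘ₗ e.symm.toLinearMap) (g := 0) (Finsupp.lhom_ext fun i a ↦ ?_) _
    exact LinearMap.congr_fun (h0 i) a
  refine ⟨θ i, hi, fun f y ↦ LinearMap.ext fun a ↦ ?_⟩
  rw [conv_eq_comp_act_right, LinearMap.comp_apply]
  change D (r.toLinearMap (e.symm (Finsupp.single i a))) (g.toLinearMap _) =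
    D (r.toLinearMap (e.symm (Finsupp.single i ((RightComodule.regular k C).act f a))))
      (g.toLinearMap y)
  rw [LeftComodule.map_act, ← hD, ← RightComodule.map_act, hS.act_symm_single]

theorem IsRightSemiperfect.isRightQcF (h : IsRightSemiperfect k C)
    (hinj : ∀ P : RightComodule k C, Projective P → Injective P) : IsRightQcF k C := by
  choose θ hθ hmul using fun c : {c : C // c ≠ 0} ↦ h.exists_linear hinj c.1 c.2
  refine ⟨{c : C // c ≠ 0},
    LinearMap.pi fun c ↦ (WithConv.linearEquiv k (C →ₗ[k] k)).symm.toLinearMap ∘ₗ θ c,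
    (injective_iff_map_eq_zero _).2 fun c hc ↦ ?_, fun c f i ↦ WithConv.ext (hmul i f.ofConv c)⟩
  by_contra hne
  exact hθ ⟨c, hne⟩ (congrArg WithConv.ofConv (congrFun hc ⟨c, hne⟩))

end

theorem proposition4p3 (k : Type u) (C : Type v) [Field k] [AddCommGroup C] [Module k C]
    [Coalgebra k C] :
    IsRightQcF k C ↔ IsRightSemiperfect k C ∧ IsQFCategory (RightComodule k C) :=
  ⟨fun h ↦ ⟨h.isRightSemiperfect, ⟨inferInstance⟩, h.isRightSemiperfect.enoughProjectives,
    fun P _ ↦ h.injective_of_projective P⟩, fun h ↦ h.1.isRightQcF h.2.2.2⟩
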